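/- Let $n\ge 1$ and let $(M,\omega)$ be an $n$-plectic manifold: $M$ is a smooth finite-dimensional manifold and $\omega$ is a closed smooth $(n+1)$-form on $M$ such that $T_xM\to\Lambda^nT_x^*M$, $v\mapsto v\lrcorner\,\omega$, is injective for every $x\in M$. For a decomposable multivector field the contraction is $(X_1\wedge\dots\wedge X_k)\lrcorner\,\tau=\tau(X_1,\dots,X_k,\cdot,\dots,\cdot)$, extended linearly; it is $0$ when $k>\deg\tau$, and forms of negative degree are $0$. For $k\ge1$ let $\Omega^{n-k}_{\mathrm{Ham}}(M)$ be the space of Hamiltonian $(n-k)$-forms, i.e. the smooth $(n-k)$-forms $\alpha$ for which there is a smooth $k$-vector field $X_\alpha\in\Gamma(\Lambda^kTM)$ (a Hamiltonian multivector field of $\alpha$) with $d\alpha=-X_\alpha\lrcorner\,\omega$; put $|\alpha|=k+1$. For $\alpha\in\Omega^{n-k}_{\mathrm{Ham}}(M)$ and $\beta\in\Omega^{n-l}_{\mathrm{Ham}}(M)$ put $$\{\alpha,\beta\}=(-1)^{|\beta|}X_\beta\lrcorner X_\alpha\lrcorner\,\omega .$$ Let $k,l,m\ge1$, $\alpha\in\Omega^{n-k}_{\mathrm{Ham}}(M)$,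 $\beta\in\Omega^{n-l}_{\mathrm{Ham}}(M)$, $\gamma\in\Omega^{n-m}_{\mathrm{Ham}}(M)$. Then: 1. $\{\alpha,\beta\}$ does not depend on the choice of the Hamiltonian multivector fields $X_\alpha,X_\beta$, and $\{\alpha,\beta\}\in\Omega^{n-(k+l-1)}_{\mathrm{Ham}}(M)$, so that $|\{\alpha,\beta\}|=|\alpha|+|\beta|-2$. 2. (Graded skew-symmetry) $\{\alpha,\beta\}=-(-1)^{|\alpha||\beta|}\{\beta,\alpha\}$. 3. (Graded Jacobi identity up to an exact term) For arbitrary Hamiltonian multivector fields $X_\alpha,X_\beta,X_\gamma$ of $\alpha,\beta,\gamma$, $$(-1)^{|\alpha||\gamma|}\{\alpha,\{\beta,\gamma\}\}+(-1)^{|\beta||\alpha|}\{\beta,\{\gamma,\alpha\}\}+(-1)^{|\gamma||\beta|}\{\gamma,\{\alpha,\beta\}\}=(-1)^{|\beta||\gamma|+|\beta||\alpha|+|\beta|}\,d\left(X_\alpha\lrcorner X_\beta\lrcorner X_\gamma\lrcorner\,\omega\right).$$ 4. The bracket descends to a well-defined bilinear bracket on $\widetilde\Omega_{\mathrm{Ham}}(M)=\bigoplus_{k=1}^{n}\Omega^{n-k}_{\mathrm{Ham}}(M)/\{\text{closed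 forms}\}$ which makes it a graded Lie algebra. Here the bracket has degree $-2$ with respect to $|\cdot|$; equivalently, if the class of $\alpha$ is given the degree $|\alpha|-2=k-1$, which changes no sign, the bracket maps $L_i\times L_j$ to $L_{i+j}$, is graded skew-symmetric, and satisfies the graded Jacobi identity. -/

import Mathlib

open scoped Manifold

noncomputable section

namespace Multisymplectic

/-! ### Contraction of an alternating form by a multivector -/

section Algebra

theorem append_update_left {V : Type*} {k p : ℕ} [DecidableEq (Fin k)] (w : Fin k → V) (v : Fin p → V)
    (i : Fin k) (a : V) :
    Fin.append (Function.update w i a) v =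
      Function.update (Fin.append w v) (Fin.castAdd p i) a := by
  funext j
  refine Fin.addCases (fun j => ?_) (fun j => ?_) j
  · by_cases h : j = i
    · subst h; simp
    · have h' : Fin.castAdd p j ≠ Fin.castAdd p i := fun e => h (Fin.castAdd_injective k p e)
      simp [Function.update_of_ne h, Function.update_of_ne h']
  · have h' : Fin.natAdd k j ≠ Fin.castAdd p i := by
      intro e
      have := congrArg Fin.val e
      simp at this
      omega
    simp [Function.update_of_ne h']

theorem append_update_right {V : Type*} {k p : ℕ} [DecidableEq (Fin p)] (w : Fin k → V) (v : Fin p → V)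
    (i : Fin p) (a : V) :
    Fin.append w (Function.update v i a) =
      Function.update (Fin.append w v) (Fin.natAdd k i) a := by
  funext j
  refine Fin.addCases (fun j => ?_) (fun j => ?_) j
  · have h' : Fin.castAdd p j ≠ Fin.natAdd k i := by
      intro e
      have := congrArg Fin.val e
      simp at this
      omega
    simp [Function.update_of_ne h']
  · by_cases h : j = i
    · subst h; simp
    · have h' : Fin.natAdd k j ≠ Fin.natAdd k i := fun e => h (Fin.natAdd_injective p k e)
      simp [Function.update_of_ne h, Function.update_of_ne h']

variable {V : Type*} [AddCommGroup V] [Module ℝ V] [TopologicalSpace V]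

/-- `v ↦ τ (w₁, …, w_k, v₁, …, v_p)` as an alternating `p`-form. -/
def insertFirst {k p : ℕ} (τ : V [⋀^Fin (k + p)]→L[ℝ] ℝ) (w : Fin k → V) :
    V [⋀^Fin p]→L[ℝ] ℝ where
  toFun v := τ (Fin.append w v)
  map_update_add' v i a b := by simp [append_update_right]
  map_update_smul' v i c a := by simp [append_update_right]
  map_eq_zero_of_eq' v i j hv hij :=
    τ.map_eq_zero_of_eq _ (i := Fin.natAdd k i) (j := Fin.natAdd k j) (by simpa using hv)
      (fun e => hij (Fin.natAdd_injective p k e))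
  cont := by
    refine τ.cont.comp (continuous_pi fun j => ?_)
    refine Fin.addCases (fun j => ?_) (fun j => ?_) j
    · simpa using continuous_const
    · simpa using continuous_apply j

theorem insertFirst_apply {k p : ℕ} (τ : V [⋀^Fin (k + p)]→L[ℝ] ℝ) (w : Fin k → V)
    (v : Fin p → V) : insertFirst τ w v = τ (Fin.append w v) := rfl

/-- `w ↦ τ (w₁, …, w_k, · , …, ·)`, alternating in `w`. -/
def insertAlternating {k p : ℕ} (τ : V [⋀^Fin (k + p)]→L[ℝ] ℝ) :
    V [⋀^Fin k]→ₗ[ℝ] (V [⋀^Fin p]→L[ℝ] ℝ) where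
  toFun w := insertFirst τ w
  map_update_add' w i a b := by
    ext v
    simp [insertFirst_apply, append_update_left]
  map_update_smul' w i c a := by
    ext v
    simp [insertFirst_apply, append_update_left]
  map_eq_zero_of_eq' w i j hw hij := by
    ext v
    exact τ.map_eq_zero_of_eq _ (i := Fin.castAdd p i) (j := Fin.castAdd p j) (by simpa using hw)
      (fun e => hij (Fin.castAdd_injective k p e))

/-- The contraction `X ⌟ τ` of a form `τ` by a multivector `X ∈ Λᵏ V`: the extension by linearity
in `X` of `(X₁ ∧ ⋯ ∧ X_k) ⌟ τ = X_k ⌟ ⋯ ⌟ X₁ ⌟ τ = τ (X₁, …, X_k, ·, …, ·)`. -/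
def contractAt {k p : ℕ} (X : ⋀[ℝ]^k V) (τ : V [⋀^Fin (k + p)]→L[ℝ] ℝ) : V [⋀^Fin p]→L[ℝ] ℝ :=
  exteriorPower.alternatingMapLinearEquiv (insertAlternating τ) X

theorem contractAt_ιMulti {k p : ℕ} (w : Fin k → V) (τ : V [⋀^Fin (k + p)]→L[ℝ] ℝ)
    (v : Fin p → V) :
    contractAt (exteriorPower.ιMulti ℝ k w) τ v = τ (Fin.append w v) := by
  simp [contractAt, insertAlternating, insertFirst_apply]

theorem contractAt_zero {k p : ℕ} (τ : V [⋀^Fin (k + p)]→L[ℝ] ℝ) :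
    contractAt (0 : ⋀[ℝ]^k V) τ = 0 := by
  simp [contractAt]

theorem contractAt_add {k p : ℕ} (X Y : ⋀[ℝ]^k V) (τ : V [⋀^Fin (k + p)]→L[ℝ] ℝ) :
    contractAt (X + Y) τ = contractAt X τ + contractAt Y τ := by
  simp [contractAt]

theorem contractAt_smul {k p : ℕ} (c : ℝ) (X : ⋀[ℝ]^k V) (τ : V [⋀^Fin (k + p)]→L[ℝ] ℝ) :
    contractAt (c • X) τ = c • contractAt X τ := by
  simp [contractAt]

end Algebra

/-! ### Differential forms and multivector fields on a manifold

`M` is a manifold modelled on the finite-dimensional real vector space `E`. -/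

section Manifold

variable (E : Type*) [NormedAddCommGroup E] [NormedSpace ℝ E]
  (M : Type*) [TopologicalSpace M] [ChartedSpace E M]

/-- Families of alternating `p`-forms on the tangent spaces (no smoothness yet). -/
abbrev FormField (p : ℕ) : Type _ :=
  ∀ x : M, TangentSpace 𝓘(ℝ, E) x [⋀^Fin p]→L[ℝ] ℝ

/-- Inhomogeneous form fields: one component in each degree `p : ℕ` (no smoothness yet). -/
def Forms : Type _ := ∀ p : ℕ, FormField E M p

instance : AddCommGroup (Forms E M) := inferInstanceAs (AddCommGroup (∀ p : ℕ, FormField E M p))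

instance : Module ℝ (Forms E M) := inferInstanceAs (Module ℝ (∀ p : ℕ, FormField E M p))

/-- Families of `k`-vectors in the tangent spaces (no smoothness yet). -/
abbrev MultiField (k : ℕ) : Type _ :=
  ∀ x : M, ⋀[ℝ]^k (TangentSpace 𝓘(ℝ, E) x)

variable {E M}

theorem Forms.add_apply (α β : Forms E M) (p : ℕ) : (α + β) p = α p + β p := rfl

theorem Forms.smul_apply (r : ℝ) (α : Forms E M) (p : ℕ) : (r • α) p = r • α p := rfl

/-- The expression of a form field in the chart at `c`: its pull-back by the inverse chart. -/
def chartForm {p : ℕ} (c : M) (α : FormField E M p) (y : E) : E [⋀^Fin p]→L[ℝ] ℝ :=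
  (α ((chartAt E c).symm y)).compContinuousLinearMap
    (mfderiv 𝓘(ℝ, E) 𝓘(ℝ, E) (chartAt E c).symm y)

/-- The expression of a multivector field in the chart at `c`: its push-forward by the chart. -/
def chartMulti {k : ℕ} (c : M) (X : MultiField E M k) (y : E) : ⋀[ℝ]^k E :=
  exteriorPower.map k
    (mfderiv 𝓘(ℝ, E) 𝓘(ℝ, E) (chartAt E c) ((chartAt E c).symm y)).toLinearMap
    (X ((chartAt E c).symm y))

/-- Smoothness of a `p`-form: all its chart expressions are smooth. -/
def IsSmoothForm {p : ℕ} (α : FormField E M p) : Prop :=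
  ∀ c : M, ContDiffOn ℝ (⊤ : ℕ∞) (chartForm c α) (chartAt E c).target

/-- Smoothness of a `k`-vector field: in all charts, all its (linear) coordinates are smooth. -/
def IsSmoothMulti {k : ℕ} (X : MultiField E M k) : Prop :=
  ∀ (c : M) (φ : (⋀[ℝ]^k E) →ₗ[ℝ] ℝ),
    ContDiffOn ℝ (⊤ : ℕ∞) (fun y => φ (chartMulti c X y)) (chartAt E c).target

/-- The exterior derivative of a `p`-form, computed at `x` in the chart at `x`. -/
def extD {p : ℕ} (α : FormField E M p) : FormField E M (p + 1) := fun x =>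
  (extDeriv (chartForm x α) (chartAt E x x)).compContinuousLinearMap
    (mfderiv 𝓘(ℝ, E) 𝓘(ℝ, E) (chartAt E x) x)

/-- The exterior derivative `d` on inhomogeneous forms. -/
def dExt (α : Forms E M) : Forms E M
  | 0 => 0
  | p + 1 => extD (α p)

/-- The contraction `X ⌟ α` of an inhomogeneous form by a `k`-vector field. Components of degree
less than `k` are sent to zero. -/
def contract {k : ℕ} (X : MultiField E M k) (α : Forms E M) : Forms E M :=
  fun p x => contractAt (X x) (α (k + p) x)

theorem chartForm_add {p : ℕ} (c : M) (α β : FormField E M p) :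
    chartForm c (α + β) = chartForm c α + chartForm c β := rfl

theorem chartForm_smul {p : ℕ} (c : M) (r : ℝ) (α : FormField E M p) :
    chartForm c (r • α) = r • chartForm c α := rfl

theorem chartForm_zero {p : ℕ} (c : M) : chartForm c (0 : FormField E M p) = 0 := rfl

theorem IsSmoothForm.differentiableAt {p : ℕ} {α : FormField E M p} (h : IsSmoothForm α) (x : M) :
    DifferentiableAt ℝ (chartForm x α) (chartAt E x x) :=
  ((h x).contDiffAt ((chartAt E x).open_target.mem_nhds
    (mem_chart_target E x))).differentiableAt (by simp)

/-- The space `Ω^j(M)` of smooth differential forms of degree `j : ℤ`; it is zero for `j < 0`. -/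
def Omega (E M : Type*) [NormedAddCommGroup E] [NormedSpace ℝ E] [TopologicalSpace M]
    [ChartedSpace E M] (j : ℤ) : Submodule ℝ (Forms E M) where
  carrier := {α | (∀ p, IsSmoothForm (α p)) ∧ ∀ p : ℕ, (p : ℤ) ≠ j → α p = 0}
  zero_mem' := ⟨fun p c => by
    change ContDiffOn ℝ (⊤ : ℕ∞) (chartForm c (0 : FormField E M p)) _
    rw [chartForm_zero]; exact contDiffOn_const, fun _ _ => rfl⟩
  add_mem' := by
    rintro α β ⟨h1, h2⟩ ⟨h3, h4⟩
    refine ⟨fun p c => ?_, fun p hp => ?_⟩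
    · exact (h1 p c).add (h3 p c)
    · rw [Forms.add_apply, h2 p hp, h4 p hp, add_zero]
  smul_mem' := by
    rintro r α ⟨h1, h2⟩
    refine ⟨fun p c => ?_, fun p hp => ?_⟩
    · exact (h1 p c).const_smul r
    · rw [Forms.smul_apply, h2 p hp, smul_zero]

theorem chartMulti_add {k : ℕ} (c : M) (X Y : MultiField E M k) (y : E) :
    chartMulti c (X + Y) y = chartMulti c X y + chartMulti c Y y :=
  map_add (exteriorPower.map k _) _ _

theorem chartMulti_smul {k : ℕ} (c : M) (r : ℝ) (X : MultiField E M k) (y : E) :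
    chartMulti c (r • X) y = r • chartMulti c X y :=
  map_smul (exteriorPower.map k _) _ _

theorem chartMulti_zero {k : ℕ} (c : M) (y : E) :
    chartMulti c (0 : MultiField E M k) y = 0 :=
  map_zero (exteriorPower.map k _)

/-- The space `Γ(Λᵏ TM)` of smooth `k`-vector fields. -/
def smoothMulti (E M : Type*) [NormedAddCommGroup E] [NormedSpace ℝ E] [TopologicalSpace M]
    [ChartedSpace E M] (k : ℕ) : Submodule ℝ (MultiField E M k) where
  carrier := {X | IsSmoothMulti X}
  zero_mem' := fun c φ => by simpa [chartMulti_zero] using contDiffOn_const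
  add_mem' := fun {X Y} hX hY c φ => by
    simpa [chartMulti_add] using (hX c φ).add (hY c φ)
  smul_mem' := fun r X hX c φ => by
    simpa [chartMulti_smul] using (hX c φ).const_smul r

theorem extD_add {p : ℕ} {α β : FormField E M p} (hα : IsSmoothForm α) (hβ : IsSmoothForm β) :
    extD (α + β) = extD α + extD β := by
  funext x
  simp only [extD, chartForm_add, Pi.add_apply,
    extDeriv_add (hα.differentiableAt x) (hβ.differentiableAt x)]
  rfl

theorem extD_smul {p : ℕ} (r : ℝ) (α : FormField E M p) : extD (r • α) = r • extD α := by
  funext x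
  simp only [extD, chartForm_smul, extDeriv_smul]
  rfl

theorem extD_zero {p : ℕ} : extD (0 : FormField E M p) = 0 := by
  have h := extD_smul (0 : ℝ) (0 : FormField E M p)
  simpa using h

theorem dExt_add {i j : ℤ} {α β : Forms E M} (hα : α ∈ Omega E M i) (hβ : β ∈ Omega E M j) :
    dExt (α + β) = dExt α + dExt β := by
  funext p
  cases p with
  | zero => exact (add_zero _).symm
  | succ p => exact extD_add (hα.1 p) (hβ.1 p)

theorem dExt_smul (r : ℝ) (α : Forms E M) : dExt (r • α) = r • dExt α := by
  funext p
  cases p with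
  | zero => exact (smul_zero r).symm
  | succ p => exact extD_smul r (α p)

theorem dExt_zero : dExt (0 : Forms E M) = 0 := by
  funext p
  cases p with
  | zero => rfl
  | succ p => exact extD_zero

theorem contract_zero {k : ℕ} (α : Forms E M) : contract (0 : MultiField E M k) α = 0 := by
  funext p x
  exact contractAt_zero _

theorem contract_add {k : ℕ} (X Y : MultiField E M k) (α : Forms E M) :
    contract (X + Y) α = contract X α + contract Y α := by
  funext p x
  exact contractAt_add _ _ _

theorem contract_smul {k : ℕ} (r : ℝ) (X : MultiField E M k) (α : Forms E M) :
    contract (r • X) α = r • contract X α := by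
  funext p x
  exact contractAt_smul _ _ _

/-! ### Multisymplectic forms, Hamiltonian forms and the generalized Poisson bracket -/

/-- `(M, ω)` is an `n`-plectic manifold: `ω` is a smooth closed `(n+1)`-form such that
`T_xM → Λⁿ T_x^*M, v ↦ v ⌟ ω` is injective for every `x`. -/
structure IsPlectic (n : ℕ) (ω : Forms E M) : Prop where
  mem : ω ∈ Omega E M (n + 1)
  closed : dExt ω = 0
  nondegenerate : ∀ (x : M) (v : TangentSpace 𝓘(ℝ, E) x),
    (∀ w : Fin n → TangentSpace 𝓘(ℝ, E) x, ω (n + 1) x (Fin.cons v w) = 0) → v = 0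

/-- `X` is a Hamiltonian `k`-vector field of `α`: it is smooth and `dα = - X ⌟ ω`. -/
def IsHamiltonianField (ω : Forms E M) {k : ℕ} (α : Forms E M) (X : MultiField E M k) : Prop :=
  X ∈ smoothMulti E M k ∧ dExt α = -contract X ω

/-- The space `Ω^{n-k}_Ham(M)` of Hamiltonian `(n-k)`-forms. It is zero for `k > n`. -/
def HamForms (n : ℕ) (ω : Forms E M) (k : ℕ) : Submodule ℝ (Forms E M) where
  carrier := {α | α ∈ Omega E M ((n : ℤ) - k) ∧
    ∃ X : MultiField E M k, IsHamiltonianField ω α X}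
  zero_mem' := ⟨zero_mem _, 0, zero_mem _, by rw [dExt_zero, contract_zero, neg_zero]⟩
  add_mem' := by
    rintro α β ⟨hα, X, hX, eX⟩ ⟨hβ, Y, hY, eY⟩
    exact ⟨add_mem hα hβ, X + Y, add_mem hX hY, by
      rw [dExt_add hα hβ, contract_add, eX, eY, neg_add]⟩
  smul_mem' := by
    rintro r α ⟨hα, X, hX, eX⟩
    exact ⟨Submodule.smul_mem _ r hα, r • X, Submodule.smul_mem _ r hX, by
      rw [dExt_smul, contract_smul, eX, smul_neg]⟩

open Classical in
/-- A choice `X_α` of a Hamiltonian `k`-vector field of `α` (zero if there is none). -/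
def hamField (ω : Forms E M) (k : ℕ) (α : Forms E M) : MultiField E M k :=
  if h : ∃ X : MultiField E M k, IsHamiltonianField ω α X then h.choose else 0

/-- The grading `|α| = k + 1` of a Hamiltonian `(n-k)`-form. -/
def hamGrade (k : ℕ) : ℕ := k + 1

/-- The generalized Poisson bracket `{α, β} = (-1)^{|β|} X_β ⌟ X_α ⌟ ω` of
`α ∈ Ω^{n-k}_Ham(M)` and `β ∈ Ω^{n-l}_Ham(M)`. -/
def poisson (ω : Forms E M) (k l : ℕ) (α β : Forms E M) : Forms E M :=
  (-1 : ℝ) ^ hamGrade l • contract (hamField ω l β) (contract (hamField ω k α) ω)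

/-- The closed forms in `Ω^{n-k}_Ham(M)`. -/
def closedHam (n : ℕ) (ω : Forms E M) (k : ℕ) : Submodule ℝ (HamForms n ω k) where
  carrier := {α | dExt (α : Forms E M) = 0}
  zero_mem' := dExt_zero
  add_mem' := by
    rintro ⟨α, hα⟩ ⟨β, hβ⟩ (h1 : dExt α = 0) (h2 : dExt β = 0)
    change dExt (α + β) = 0
    rw [dExt_add hα.1 hβ.1, h1, h2, add_zero]
  smul_mem' := by
    rintro r ⟨α, hα⟩ (h1 : dExt α = 0)
    change dExt (r • α) = 0
    rw [dExt_smul, h1, smul_zero]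

/-- The component of degree `i = |α| - 2 = k - 1` of the graded space
`⨁_{k ≥ 1} Ω^{n-k}_Ham(M) / closed forms`. -/
abbrev HamQuot (n : ℕ) (ω : Forms E M) (i : ℕ) : Type _ :=
  HamForms n ω (i + 1) ⧸ closedHam n ω (i + 1)

end Manifold

/-- A bilinear bracket `L_i × L_j → L_{i+j}` making `⨁ L_i` a graded Lie algebra
(concentrated in degrees `≥ 0`): graded skew-symmetry and the graded Jacobi identity for
homogeneous elements, as equalities in `⨁ L_i`. -/
structure IsGradedLieBracket (L : ℕ → Type*) [∀ i, AddCommGroup (L i)] [∀ i, Module ℝ (L i)]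
    (br : ∀ i j : ℕ, L i →ₗ[ℝ] L j →ₗ[ℝ] L (i + j)) : Prop where
  skew : ∀ (i j : ℕ) (x : L i) (y : L j),
    DirectSum.lof ℝ ℕ L (i + j) (br i j x y) =
      -((-1 : ℝ) ^ (i * j) • DirectSum.lof ℝ ℕ L (j + i) (br j i y x))
  jacobi : ∀ (i j k : ℕ) (x : L i) (y : L j) (z : L k),
    (-1 : ℝ) ^ (i * k) • DirectSum.lof ℝ ℕ L (i + (j + k)) (br i (j + k) x (br j k y z)) +
      (-1 : ℝ) ^ (j * i) • DirectSum.lof ℝ ℕ L (j + (k + i)) (br j (k + i) y (br k i z x)) +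
      (-1 : ℝ) ^ (k * j) • DirectSum.lof ℝ ℕ L (k + (i + j)) (br k (i + j) z (br i j x y)) = 0

end Multisymplectic

end

open Multisymplectic

/-!
An inhomogeneous form is a functional on the exterior algebra, and contraction with a multivector
is precomposition with left multiplication by it. So `ι_X` and `ι_Y` graded-commute. With
`L_X = [d, ι_X]` the Lie derivative, the graded commutator `[L_X, ι_Y]` involves no derivative of
the form it acts on: in a chart `d = ∑ dxᵃ ∧ ∂_a`, the derivatives of the form cancel, and
`[L_X, ι_Y]` is contraction with the Schouten bracket `[X, Y]`.

If `ω` is closed and `X`, `Y` are Hamiltonian fields of `α`, `β`, then `L_X ω = -ddα = 0` and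
`d (Y ⌟ ω) = -ddβ = 0`, so that `[X, Y] ⌟ ω = ± L_X (Y ⌟ ω) = ± d (X ⌟ Y ⌟ ω)`: with the signs
chosen here, `[X, Y]` is a Hamiltonian field of `{α, β}`. The Jacobi identity up to an exact term
is then the expansion of `[L_X, ι_Y] (Z ⌟ ω)`.
-/

open scoped Topology

noncomputable section

namespace Multisymplectic

theorem neg_one_pow_eq_neg_of_even_iff_odd {R : Type*} [Monoid R] [HasDistribNeg R] {m n : ℕ}
    (h : Even m ↔ Odd n) : (-1 : R) ^ m = -(-1) ^ n := by
  rw [neg_one_pow_congr (n := n + 1) (by rw [h, Nat.even_add_one, Nat.not_even_iff_odd]),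
    pow_succ, mul_neg_one]

theorem neg_one_pow_smul_eq_iff {R V : Type*} [Ring R] [AddCommGroup V] [Module R V] {m : ℕ}
    {a b : V} : (-1 : R) ^ m • a = b ↔ a = (-1 : R) ^ m • b := by
  have hsq : (-1 : R) ^ m * (-1) ^ m = 1 := by
    rw [← pow_add, (Even.add_self m).neg_one_pow]
  constructor <;> rintro rfl <;> rw [smul_smul, hsq, one_smul]

/-! ### The exterior algebra -/

section ExteriorAlgebra

open CliffordAlgebra (contractLeft involute)

theorem contractLeft_mul {R V : Type*} [CommRing R] [AddCommGroup V] [Module R V]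
    {Q : QuadraticForm R V} (d : Module.Dual R V) (a b : CliffordAlgebra Q) :
    contractLeft d (a * b) = contractLeft d a * b + involute a * contractLeft d b := by
  induction a using CliffordAlgebra.left_induction with
  | algebraMap r =>
    rw [CliffordAlgebra.contractLeft_algebraMap_mul, CliffordAlgebra.contractLeft_algebraMap,
      zero_mul, zero_add, AlgHom.commutes]
  | add x y hx hy => simp only [add_mul, map_add, hx, hy]; abel
  | ι_mul x v hx =>
    simp only [mul_assoc, CliffordAlgebra.contractLeft_ι_mul, hx, map_mul,
      CliffordAlgebra.involute_ι, sub_mul, mul_add, neg_mul, smul_mul_assoc]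
    abel

variable {R V W : Type*} [CommRing R] [AddCommGroup V] [Module R V] [AddCommGroup W] [Module R W]

theorem ι_mul_eq_involute_mul_ι (v : V) (Y : ExteriorAlgebra R V) :
    ExteriorAlgebra.ι R v * Y =
      involute (Q := (0 : QuadraticForm R V)) Y * ExteriorAlgebra.ι R v := by
  induction Y using CliffordAlgebra.left_induction with
  | algebraMap r => rw [AlgHom.commutes, Algebra.commutes]
  | add x y hx hy => rw [mul_add, map_add, add_mul, hx, hy]
  | ι_mul x w hx =>
    rw [map_mul, CliffordAlgebra.involute_ι, mul_assoc, ← hx, ← mul_assoc, ← mul_assoc, neg_mul,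
      eq_neg_of_add_eq_zero_left (ExteriorAlgebra.ι_add_mul_swap v w)]

theorem involute_of_mem {k : ℕ} {X : ExteriorAlgebra R V} (hX : X ∈ ⋀[R]^k V) :
    involute (Q := (0 : QuadraticForm R V)) X = (-1 : R) ^ k • X := by
  induction hX using Submodule.pow_induction_on_left' with
  | algebraMap r => rw [AlgHom.commutes, pow_zero, one_smul]
  | add x y i _ _ hx hy => rw [map_add, hx, hy, smul_add]
  | mem_mul v hv i x _ hx =>
    obtain ⟨v, rfl⟩ := hv
    rw [map_mul, hx, CliffordAlgebra.involute_ι, pow_succ, mul_neg_one, neg_smul, neg_mul,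
      mul_smul_comm]

theorem mul_comm_of_mem {k l : ℕ} {X Y : ExteriorAlgebra R V} (hX : X ∈ ⋀[R]^k V)
    (hY : Y ∈ ⋀[R]^l V) : X * Y = (-1 : R) ^ (k * l) • (Y * X) := by
  induction hX using Submodule.pow_induction_on_left' with
  | algebraMap r => rw [zero_mul, pow_zero, one_smul, Algebra.commutes]
  | add x y i _ _ hx hy => rw [add_mul, mul_add, hx, hy, smul_add]
  | mem_mul v hv i x _ hx =>
    obtain ⟨v, rfl⟩ := hv
    rw [mul_assoc, hx, mul_smul_comm, ← mul_assoc, ι_mul_eq_involute_mul_ι, involute_of_mem hY,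
      smul_mul_assoc, smul_mul_assoc, smul_smul, mul_assoc, ← pow_add, Nat.succ_mul]

/-- The interior product of a covector with multivectors. -/
abbrev interior (d : Module.Dual R V) : ExteriorAlgebra R V →ₗ[R] ExteriorAlgebra R V :=
  contractLeft (Q := 0) d

theorem interior_mul_of_mem {k : ℕ} (d : Module.Dual R V) {X : ExteriorAlgebra R V}
    (hX : X ∈ ⋀[R]^k V) (u : ExteriorAlgebra R V) :
    interior d (X * u) = interior d X * u + (-1 : R) ^ k • (X * interior d u) := by
  rw [← smul_mul_assoc, ← involute_of_mem hX]
  exact contractLeft_mul d X u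

theorem ι_mul_interior_mem {k : ℕ} (d : Module.Dual R V) (v : V) {X : ExteriorAlgebra R V}
    (hX : X ∈ ⋀[R]^k V) : ExteriorAlgebra.ι R v * interior d X ∈ ⋀[R]^k V := by
  induction hX using Submodule.pow_induction_on_left' generalizing v with
  | algebraMap r => simp
  | add x y i _ _ hx hy => rw [map_add, mul_add]; exact add_mem (hx v) (hy v)
  | mem_mul w hw i x hx ih =>
    obtain ⟨w, rfl⟩ := hw
    have hv : ExteriorAlgebra.ι R v ∈ LinearMap.range (ExteriorAlgebra.ι R) := ⟨v, rfl⟩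
    rw [interior, CliffordAlgebra.contractLeft_ι_mul, mul_sub, mul_smul_comm,
      ExteriorAlgebra.exteriorPower, Nat.succ_eq_add_one, pow_succ']
    exact sub_mem (Submodule.smul_mem _ _ (Submodule.mul_mem_mul hv hx))
      (Submodule.mul_mem_mul hv (ih w))

theorem interior_mem {k : ℕ} (d : Module.Dual R V) {X : ExteriorAlgebra R V}
    (hX : X ∈ ⋀[R]^(k + 1) V) : interior d X ∈ ⋀[R]^k V := by
  rw [ExteriorAlgebra.exteriorPower, pow_succ'] at hX
  induction hX using Submodule.mul_induction_on' with
  | mem_mul_mem v hv x hx =>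
    obtain ⟨v, rfl⟩ := hv
    rw [interior, CliffordAlgebra.contractLeft_ι_mul]
    exact sub_mem (Submodule.smul_mem _ _ hx) (ι_mul_interior_mem d v hx)
  | add x _ y _ hx hy => rw [map_add]; exact add_mem hx hy

theorem interior_ιMulti {p : ℕ} (d : Module.Dual R V) (v : Fin (p + 1) → V) :
    interior d (ExteriorAlgebra.ιMulti R (p + 1) v) =
      ∑ i, ((-1 : R) ^ i.val * d (v i)) • ExteriorAlgebra.ιMulti R p (i.removeNth v) := by
  induction p with
  | zero => simp [ExteriorAlgebra.ιMulti_succ_apply, Algebra.algebraMap_eq_smul_one]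
  | succ p ih =>
    have ιMulti_removeNth_succ (i : Fin (p + 1)) :
        ExteriorAlgebra.ιMulti R (p + 1) (i.succ.removeNth v) =
          ExteriorAlgebra.ι R (v 0) *
            ExteriorAlgebra.ιMulti R p (i.removeNth (Matrix.vecTail v)) := by
      rw [ExteriorAlgebra.ιMulti_succ_apply]
      congr 2
      funext j
      simp [Matrix.vecTail, Fin.removeNth]
    rw [ExteriorAlgebra.ιMulti_succ_apply, interior, CliffordAlgebra.contractLeft_ι_mul, ih,
      Finset.mul_sum, Fin.sum_univ_succ (n := p + 1), sub_eq_add_neg, ← Finset.sum_neg_distrib]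
    congr 1
    · rw [Fin.val_zero, pow_zero, one_mul]; rfl
    · refine Finset.sum_congr rfl fun i _ => ?_
      rw [ιMulti_removeNth_succ, mul_smul_comm, ← neg_smul, Fin.val_succ, pow_succ, mul_neg_one,
        neg_mul]
      rfl

theorem exteriorPower_induction {k : ℕ} {P : ⋀[R]^k V → Prop}
    (ιMulti : ∀ v : Fin k → V, P (exteriorPower.ιMulti R k v))
    (add : ∀ X Y, P X → P Y → P (X + Y)) (smul : ∀ (r : R) X, P X → P (r • X))
    (X : ⋀[R]^k V) : P X := by
  have hX : X ∈ Submodule.span R (Set.range (exteriorPower.ιMulti R k (M := V))) :=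
    exteriorPower.ιMulti_span R k V ▸ Submodule.mem_top
  induction hX using Submodule.span_induction with
  | mem x h => obtain ⟨v, rfl⟩ := h; exact ιMulti v
  | zero => simpa using smul 0 _ (ιMulti 0)
  | add x y _ _ hx hy => exact add _ _ hx hy
  | smul r x _ hx => exact smul _ _ hx

theorem coe_exteriorPower_map {k : ℕ} (f : V →ₗ[R] W) (X : ⋀[R]^k V) :
    (exteriorPower.map k f X : ExteriorAlgebra R W) = ExteriorAlgebra.map f X := by
  induction X using exteriorPower_induction with
  | ιMulti v => simp [ExteriorAlgebra.map_apply_ιMulti]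
  | add X Y hX hY => simp [hX, hY]
  | smul r X hX => simp [hX]

end ExteriorAlgebra

/-! ### Inhomogeneous forms as functionals on the exterior algebra -/

section Pairing

variable {V W : Type*} [AddCommGroup V] [Module ℝ V] [TopologicalSpace V]
  [AddCommGroup W] [Module ℝ W] [TopologicalSpace W]

/-- The pairing of inhomogeneous alternating forms with the exterior algebra; in degree `p` it is
`⟨τ, v₁ ∧ ⋯ ∧ v_p⟩ = τ (v₁, …, v_p)`. -/
def pairing : (∀ p, V [⋀^Fin p]→L[ℝ] ℝ) →ₗ[ℝ] ExteriorAlgebra ℝ V →ₗ[ℝ] ℝ :=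
  ExteriorAlgebra.liftAlternating ∘ₗ
    LinearMap.pi fun p => ContinuousAlternatingMap.toAlternatingMapLinear ∘ₗ LinearMap.proj p

@[simp]
theorem pairing_ιMulti (τ : ∀ p, V [⋀^Fin p]→L[ℝ] ℝ) {p : ℕ} (v : Fin p → V) :
    pairing τ (ExteriorAlgebra.ιMulti ℝ p v) = τ p v :=
  ExteriorAlgebra.liftAlternating_apply_ιMulti _ v

theorem pairing_injective : Function.Injective (pairing (V := V)) := by
  intro τ σ h
  funext p
  ext v
  rw [← pairing_ιMulti τ, h, pairing_ιMulti]

theorem contractAt_add_right {k p : ℕ} (X : ⋀[ℝ]^k V) (τ σ : V [⋀^Fin (k + p)]→L[ℝ] ℝ) :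
    contractAt X (τ + σ) = contractAt X τ + contractAt X σ := by
  have h : insertAlternating (τ + σ) = insertAlternating τ + insertAlternating σ := rfl
  simp [contractAt, h]

theorem contractAt_smul_right {k p : ℕ} (r : ℝ) (X : ⋀[ℝ]^k V)
    (τ : V [⋀^Fin (k + p)]→L[ℝ] ℝ) : contractAt X (r • τ) = r • contractAt X τ := by
  have h : insertAlternating (r • τ) = r • insertAlternating τ := rfl
  simp [contractAt, h]

theorem pairing_contractAt {k : ℕ} (X : ⋀[ℝ]^k V) (τ : ∀ p, V [⋀^Fin p]→L[ℝ] ℝ)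
    (u : ExteriorAlgebra ℝ V) :
    pairing (fun p => contractAt X (τ (k + p))) u = pairing τ (X * u) := by
  suffices pairing (fun p => contractAt X (τ (k + p))) =
      pairing τ ∘ₗ LinearMap.mulLeft ℝ (X : ExteriorAlgebra ℝ V) from DFunLike.congr_fun this u
  refine ExteriorAlgebra.lhom_ext fun p => AlternatingMap.ext fun v => ?_
  simp only [LinearMap.compAlternatingMap_apply, LinearMap.comp_apply, LinearMap.mulLeft_apply,
    pairing_ιMulti]
  induction X using exteriorPower_induction with
  | ιMulti w =>
    rw [exteriorPower.ιMulti_apply_coe, ExteriorAlgebra.ιMulti_mul_ιMulti, pairing_ιMulti,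
      contractAt_ιMulti]
  | add X Y hX hY =>
    rw [contractAt_add, ContinuousAlternatingMap.add_apply, hX, hY, Submodule.coe_add, add_mul,
      map_add]
  | smul r X hX =>
    rw [contractAt_smul, ContinuousAlternatingMap.smul_apply, hX, Submodule.coe_smul,
      smul_mul_assoc, map_smul]

theorem pairing_compContinuousLinearMap (τ : ∀ p, V [⋀^Fin p]→L[ℝ] ℝ) (f : W →L[ℝ] V)
    (u : ExteriorAlgebra ℝ W) :
    pairing (fun p => (τ p).compContinuousLinearMap f) u =
      pairing τ (ExteriorAlgebra.map f.toLinearMap u) := by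
  suffices pairing (fun p => (τ p).compContinuousLinearMap f) =
      pairing τ ∘ₗ (ExteriorAlgebra.map f.toLinearMap).toLinearMap from DFunLike.congr_fun this u
  refine ExteriorAlgebra.lhom_ext fun p => AlternatingMap.ext fun v => ?_
  simp only [LinearMap.compAlternatingMap_apply, LinearMap.comp_apply, AlgHom.toLinearMap_apply,
    ExteriorAlgebra.map_apply_ιMulti, pairing_ιMulti]
  rfl

/-- The contraction `X ⌟ τ` as a bilinear map. -/
def contractₗ (k p : ℕ) :
    ⋀[ℝ]^k V →ₗ[ℝ] (V [⋀^Fin (k + p)]→L[ℝ] ℝ) →ₗ[ℝ] V [⋀^Fin p]→L[ℝ] ℝ :=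
  LinearMap.mk₂ ℝ contractAt contractAt_add contractAt_smul contractAt_add_right
    contractAt_smul_right

end Pairing

/-! ### Multivectors on a finite-dimensional space -/

section FiniteDimensional

variable {E : Type*} [NormedAddCommGroup E] [NormedSpace ℝ E]

theorem pairing_eq_of_extDeriv {ι : Type*} [Fintype ι] (b : Module.Basis ι ℝ E)
    {T : ∀ p, E → E [⋀^Fin p]→L[ℝ] ℝ} {S : ∀ p, E [⋀^Fin p]→L[ℝ] ℝ} {y : E} (h0 : S 0 = 0)
    (hsucc : ∀ p, S (p + 1) = extDeriv (T p) y) (u : ExteriorAlgebra ℝ E) :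
    pairing S u = ∑ a, pairing (fun p => fderiv ℝ (T p) y (b a)) (interior (b.coord a) u) := by
  suffices pairing S = ∑ a, pairing (fun p => fderiv ℝ (T p) y (b a)) ∘ₗ interior (b.coord a) by
    rw [this, LinearMap.sum_apply]; rfl
  refine ExteriorAlgebra.lhom_ext fun p => AlternatingMap.ext fun v => ?_
  simp only [LinearMap.compAlternatingMap_apply, LinearMap.sum_apply, LinearMap.comp_apply,
    pairing_ιMulti]
  cases p with
  | zero => simp [h0]
  | succ p =>
    simp only [interior_ιMulti, map_sum, map_smul, pairing_ιMulti]
    rw [hsucc, extDeriv, ContinuousAlternatingMap.alternatizeUncurryFin_apply, Finset.sum_comm]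
    refine Finset.sum_congr rfl fun i _ => ?_
    conv_lhs => rw [← b.sum_repr (v i)]
    simp [Finset.mul_sum, mul_assoc, -Module.Basis.sum_repr]

theorem contDiffOn_iff_forall_linearMap {G F : Type*} [NormedAddCommGroup G] [NormedSpace ℝ G]
    [NormedAddCommGroup F] [NormedSpace ℝ F] [FiniteDimensional ℝ F] {n : WithTop ℕ∞} {f : G → F}
    {s : Set G} :
    ContDiffOn ℝ n f s ↔ ∀ φ : F →ₗ[ℝ] ℝ, ContDiffOn ℝ n (fun y => φ (f y)) s := by
  refine ⟨fun h φ => h.continuousLinearMap_comp φ.toContinuousLinearMap, fun h => ?_⟩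
  rw [← (Module.finBasis ℝ F).equivFunL.comp_contDiffOn_iff, contDiffOn_pi]
  exact fun i => h ((Module.finBasis ℝ F).coord i)

theorem contDiffOn_bilinear {G F F' F'' : Type*} [NormedAddCommGroup G] [NormedSpace ℝ G]
    [NormedAddCommGroup F] [NormedSpace ℝ F] [FiniteDimensional ℝ F] [NormedAddCommGroup F']
    [NormedSpace ℝ F'] [FiniteDimensional ℝ F'] [NormedAddCommGroup F''] [NormedSpace ℝ F'']
    (B : F →ₗ[ℝ] F' →ₗ[ℝ] F'') {n : WithTop ℕ∞} {f : G → F} {g : G → F'} {s : Set G}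
    (hf : ContDiffOn ℝ n f s) (hg : ContDiffOn ℝ n g s) :
    ContDiffOn ℝ n (fun y => B (f y) (g y)) s :=
  B.toContinuousBilinearMap.isBoundedBilinearMap.contDiff.comp_contDiffOn (hf.prodMk hg)

variable [FiniteDimensional ℝ E]

instance finiteDimensional_continuousAlternatingMap {p : ℕ} :
    FiniteDimensional ℝ (E [⋀^Fin p]→L[ℝ] ℝ) :=
  Module.Finite.of_injective
    ({ toFun := fun τ => τ.toMultilinearMap
       map_add' := fun _ _ => rfl
       map_smul' := fun _ _ => rfl } :
      (E [⋀^Fin p]→L[ℝ] ℝ) →ₗ[ℝ] MultilinearMap ℝ (fun _ : Fin p => E) ℝ)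
    (fun _ _ h => ContinuousAlternatingMap.ext fun v => congrArg (fun f => f v) h)

theorem continuous_multilinearMap {p : ℕ} (f : MultilinearMap ℝ (fun _ : Fin p => E) ℝ) :
    Continuous f := by
  let b := Module.finBasis ℝ E
  have expand (v : Fin p → E) : f v =
      ∑ r : Fin p → Fin (Module.finrank ℝ E), (∏ i, b.repr (v i) (r i)) * f fun i => b (r i) := by
    conv_lhs => rw [← funext fun i => b.sum_repr (v i)]
    simp only [MultilinearMap.map_sum, MultilinearMap.map_smul_univ, smul_eq_mul]
  rw [funext expand]
  refine continuous_finsetSum _ fun r _ => (continuous_finsetProd _ fun i _ => ?_).mul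
    continuous_const
  exact (b.coord (r i)).continuous_of_finiteDimensional.comp (continuous_apply i)

theorem exteriorPower_ext_pairing {k : ℕ} {X Y : ⋀[ℝ]^k E}
    (h : ∀ τ : ∀ p, E [⋀^Fin p]→L[ℝ] ℝ, pairing τ X = pairing τ Y) : X = Y := by
  rw [← sub_eq_zero, ← Module.forall_dual_apply_eq_zero_iff ℝ]
  intro φ
  let η : E [⋀^Fin k]→L[ℝ] ℝ :=
    { φ.compAlternatingMap (exteriorPower.ιMulti ℝ k) with
      cont := continuous_multilinearMap _ }
  have pairing_η (X : ⋀[ℝ]^k E) : pairing (Pi.single k η) X = φ X := by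
    induction X using exteriorPower_induction with
    | ιMulti w =>
      rw [exteriorPower.ιMulti_apply_coe, pairing_ιMulti, Pi.single_eq_same]
      rfl
    | add X Y hX hY => rw [Submodule.coe_add, map_add, hX, hY, map_add]
    | smul r X hX => rw [Submodule.coe_smul, map_smul, hX, map_smul]
  rw [map_sub, ← pairing_η, ← pairing_η, h, sub_self]

/-- A norm on `⋀ᵏ E`, transported from coordinates. Mathlib has none; the choice is immaterial in
finite dimension, and it makes `fderiv` and `ContDiffOn` available for multivector fields. -/
scoped instance normedAddCommGroupExteriorPower (k : ℕ) : NormedAddCommGroup (⋀[ℝ]^k E) :=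
  .induced _ _ (Module.finBasis ℝ (⋀[ℝ]^k E)).equivFun (LinearEquiv.injective _)

scoped instance normedSpaceExteriorPower (k : ℕ) : NormedSpace ℝ (⋀[ℝ]^k E) :=
  .induced _ _ _ (Module.finBasis ℝ (⋀[ℝ]^k E)).equivFun

theorem hasFDerivAt_contractAt {G : Type*} [NormedAddCommGroup G] [NormedSpace ℝ G] {k p : ℕ}
    {X : G → ⋀[ℝ]^k E} {τ : G → E [⋀^Fin (k + p)]→L[ℝ] ℝ} {y : G}
    (hX : DifferentiableAt ℝ X y) (hτ : DifferentiableAt ℝ τ y) :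
    HasFDerivAt (fun y => contractAt (X y) (τ y))
      ((contractₗ k p).toContinuousBilinearMap.precompR G (X y) (fderiv ℝ τ y) +
        (contractₗ k p).toContinuousBilinearMap.precompL G (fderiv ℝ X y) (τ y)) y :=
  (contractₗ k p).toContinuousBilinearMap.hasFDerivAt_of_bilinear hX.hasFDerivAt hτ.hasFDerivAt

theorem fderiv_contractAt {G : Type*} [NormedAddCommGroup G] [NormedSpace ℝ G] {k p : ℕ}
    {X : G → ⋀[ℝ]^k E} {τ : G → E [⋀^Fin (k + p)]→L[ℝ] ℝ} {y : G}
    (hX : DifferentiableAt ℝ X y) (hτ : DifferentiableAt ℝ τ y) (v : G) :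
    fderiv ℝ (fun y => contractAt (X y) (τ y)) y v =
      contractAt (fderiv ℝ X y v) (τ y) + contractAt (X y) (fderiv ℝ τ y v) := by
  rw [(hasFDerivAt_contractAt hX hτ).fderiv, add_comm]
  rfl

/-- The bilinear map `(A, Z) ↦ ∑ₐ A eₐ ∧ (eᵃ ⌟ Z)` for a basis `eₐ` of `E` with dual basis `eᵃ`.
At `A = ∂X` and `Z = Y` it gives one of the two terms of the Schouten bracket of `X` and `Y`. The
degree `m` is a separate argument so that both terms can be given the same type. -/
def wedgeInterior {k l m : ℕ} (h : k + l = m) :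
    (E →L[ℝ] ⋀[ℝ]^k E) →ₗ[ℝ] ⋀[ℝ]^(l + 1) E →ₗ[ℝ] ⋀[ℝ]^m E :=
  let b := Module.finBasis ℝ E
  LinearMap.mk₂ ℝ
    (fun A Z => ⟨∑ a, (A (b a) : ExteriorAlgebra ℝ E) * interior (b.coord a) Z,
      Submodule.sum_mem _ fun a _ => h ▸ SetLike.mul_mem_graded (A := fun i : ℕ => ⋀[ℝ]^i E)
        (A (b a)).2 (interior_mem (b.coord a) Z.2)⟩)
    (fun A B Z => Subtype.ext <| by simp [add_mul, Finset.sum_add_distrib])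
    (fun r A Z => Subtype.ext <| by simp [Finset.smul_sum])
    (fun A Z W => Subtype.ext <| by simp [mul_add, Finset.sum_add_distrib])
    (fun r A Z => Subtype.ext <| by simp [Finset.smul_sum])

theorem coe_wedgeInterior {k l m : ℕ} (h : k + l = m) (A : E →L[ℝ] ⋀[ℝ]^k E)
    (Z : ⋀[ℝ]^(l + 1) E) :
    (wedgeInterior h A Z : ExteriorAlgebra ℝ E) =
      ∑ a, (A (Module.finBasis ℝ E a) : ExteriorAlgebra ℝ E) *
        interior ((Module.finBasis ℝ E).coord a) Z :=
  rfl

/-- The Schouten bracket of multivector fields on a vector space, where `X` has degree `k + 1` and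
`Y` has degree `l + 1`. For `k = l = 0` it is the Lie bracket of vector fields. -/
def localSchouten {k l : ℕ} (X : E → ⋀[ℝ]^(k + 1) E) (Y : E → ⋀[ℝ]^(l + 1) E) (y : E) :
    ⋀[ℝ]^(k + l + 1) E :=
  (-1 : ℝ) ^ (k * l) • wedgeInterior (by omega) (fderiv ℝ Y y) (X y) -
    wedgeInterior (by omega) (fderiv ℝ X y) (Y y)

theorem contDiffOn_localSchouten {k l : ℕ} {X : E → ⋀[ℝ]^(k + 1) E} {Y : E → ⋀[ℝ]^(l + 1) E}
    {m n : WithTop ℕ∞} {s : Set E} (hs : IsOpen s) (hmn : m + 1 ≤ n) (hX : ContDiffOn ℝ n X s)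
    (hY : ContDiffOn ℝ n Y s) : ContDiffOn ℝ m (localSchouten X Y) s := by
  have hm : m ≤ n := le_self_add.trans hmn
  exact ((contDiffOn_bilinear _ (hY.fderiv_of_isOpen hs hmn) (hX.of_le hm)).const_smul _).sub
    (contDiffOn_bilinear _ (hX.fderiv_of_isOpen hs hmn) (hY.of_le hm))

end FiniteDimensional

/-! ### Forms and multivector fields in charts -/

theorem forall_mem_chart_target {H M : Type*} [TopologicalSpace H] [TopologicalSpace M]
    [ChartedSpace H M] {c : M} {P : H → Prop}
    (h : ∀ x ∈ (chartAt H c).source, P (chartAt H c x)) : ∀ y ∈ (chartAt H c).target, P y :=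
  fun _ hy => (chartAt H c).right_inv hy ▸ h _ ((chartAt H c).map_target hy)

theorem eventually_nhds_chart {H M : Type*} [TopologicalSpace H] [TopologicalSpace M]
    [ChartedSpace H M] {c x : M} (hx : x ∈ (chartAt H c).source) {P : H → Prop}
    (h : ∀ x ∈ (chartAt H c).source, P (chartAt H c x)) : ∀ᶠ y in 𝓝 (chartAt H c x), P y :=
  Filter.mem_of_superset ((chartAt H c).open_target.mem_nhds ((chartAt H c).map_source hx))
    (forall_mem_chart_target h)

section Charts

variable {E : Type*} [NormedAddCommGroup E] [NormedSpace ℝ E]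
  {M : Type*} [TopologicalSpace M] [ChartedSpace E M]

/-- The linear map `E → T_x M` induced by the chart at `c`, as the derivative of its inverse. -/
def chartFrame (c x : M) : E →L[ℝ] TangentSpace 𝓘(ℝ, E) x :=
  mfderiv 𝓘(ℝ, E) 𝓘(ℝ, E) (chartAt E c).symm (chartAt E c x)

theorem chartForm_apply_chart {p : ℕ} {c x : M} (hx : x ∈ (chartAt E c).source)
    (α : FormField E M p) :
    chartForm c α (chartAt E c x) = (α x).compContinuousLinearMap (chartFrame c x) := by
  let α' : M → E [⋀^Fin p]→L[ℝ] ℝ := α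
  change (α' ((chartAt E c).symm (chartAt E c x))).compContinuousLinearMap _ = _
  rw [(chartAt E c).left_inv hx]
  rfl

theorem chartMulti_apply_chart {k : ℕ} {c x : M} (hx : x ∈ (chartAt E c).source)
    (X : MultiField E M k) :
    chartMulti c X (chartAt E c x) =
      exteriorPower.map k (mfderiv 𝓘(ℝ, E) 𝓘(ℝ, E) (chartAt E c) x).toLinearMap (X x) := by
  let push (x : M) : ⋀[ℝ]^k E :=
    exteriorPower.map k (mfderiv 𝓘(ℝ, E) 𝓘(ℝ, E) (chartAt E c) x).toLinearMap (X x)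
  exact congrArg push ((chartAt E c).left_inv hx)

section FirstOrder

variable [IsManifold 𝓘(ℝ, E) 1 M]

theorem mfderiv_chartFrame {c x : M} (hx : x ∈ (chartAt E c).source) (v : E) :
    mfderiv 𝓘(ℝ, E) 𝓘(ℝ, E) (chartAt E c) x (chartFrame c x v) = v :=
  ((mdifferentiable_chart (I := 𝓘(ℝ, E)) c).mfderiv hx).apply_symm_apply v

theorem chartFrame_mfderiv {c x : M} (hx : x ∈ (chartAt E c).source)
    (v : TangentSpace 𝓘(ℝ, E) x) :
    chartFrame (E := E) c x (mfderiv 𝓘(ℝ, E) 𝓘(ℝ, E) (chartAt E c) x v) = v :=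
  ((mdifferentiable_chart (I := 𝓘(ℝ, E)) c).mfderiv hx).symm_apply_apply v

theorem fderiv_coordChange {c c' x : M} (hx : x ∈ (chartAt E c).source)
    (hx' : x ∈ (chartAt E c').source) (v : E) :
    fderiv ℝ (chartAt E c ∘ (chartAt E c').symm) (chartAt E c' x) v =
      mfderiv 𝓘(ℝ, E) 𝓘(ℝ, E) (chartAt E c) x (chartFrame c' x v) := by
  have hinv := (chartAt E c').left_inv hx'
  have hsymm := (mdifferentiable_chart (I := 𝓘(ℝ, E)) c').mdifferentiableAt_symm
    ((chartAt E c').map_source hx')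
  have hc := (mdifferentiable_chart (I := 𝓘(ℝ, E)) c).mdifferentiableAt hx
  rw [← mfderiv_eq_fderiv, mfderiv_comp_of_eq hc hsymm hinv]
  let D (x : M) : E →L[ℝ] E := mfderiv 𝓘(ℝ, E) 𝓘(ℝ, E) (chartAt E c) x
  exact congrArg (fun x' => D x' (chartFrame c' x v)) hinv

theorem chartForm_eventuallyEq_pullback {p : ℕ} (α : FormField E M p) {c c' x : M}
    (hx : x ∈ (chartAt E c).source) (hx' : x ∈ (chartAt E c').source) :
    chartForm c' α =ᶠ[𝓝 (chartAt E c' x)] fun y =>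
      (chartForm c α ((chartAt E c ∘ (chartAt E c').symm) y)).compContinuousLinearMap
        (fderiv ℝ (chartAt E c ∘ (chartAt E c').symm) y) := by
  have hsource : (chartAt E c').target ∩ (chartAt E c').symm ⁻¹' (chartAt E c).source ∈
      𝓝 (chartAt E c' x) :=
    ((chartAt E c').isOpen_inter_preimage_symm (chartAt E c).open_source).mem_nhds
      ⟨(chartAt E c').map_source hx', by rwa [Set.mem_preimage, (chartAt E c').left_inv hx']⟩
  filter_upwards [hsource] with y ⟨hy', hy⟩
  obtain ⟨z, hz', rfl⟩ := (chartAt E c').surjOn hy'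
  rw [Set.mem_preimage, (chartAt E c').left_inv hz'] at hy
  rw [Function.comp_apply, (chartAt E c').left_inv hz', chartForm_apply_chart hz',
    chartForm_apply_chart hy]
  ext v
  refine congrArg (α z) (funext fun i => ?_)
  exact ((congrArg (chartFrame c z) (fderiv_coordChange hy hz' (v i))).trans
    (chartFrame_mfderiv hy _)).symm

end FirstOrder

section Smooth

variable [IsManifold 𝓘(ℝ, E) (⊤ : ℕ∞) M]

theorem contDiffAt_coordChange {c c' x : M} (hx : x ∈ (chartAt E c).source)
    (hx' : x ∈ (chartAt E c').source) :
    ContDiffAt ℝ (⊤ : ℕ∞) (chartAt E c ∘ (chartAt E c').symm) (chartAt E c' x) := by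
  rw [← contMDiffAt_iff_contDiffAt]
  have hc : ContMDiffAt 𝓘(ℝ, E) 𝓘(ℝ, E) (⊤ : ℕ∞) (chartAt E c) x :=
    contMDiffOn_chart.contMDiffAt ((chartAt E c).open_source.mem_nhds hx)
  have hsymm : ContMDiffAt 𝓘(ℝ, E) 𝓘(ℝ, E) (⊤ : ℕ∞) (chartAt E c').symm (chartAt E c' x) :=
    contMDiffOn_chart_symm.contMDiffAt
      ((chartAt E c').open_target.mem_nhds ((chartAt E c').map_source hx'))
  exact hc.comp_of_eq hsymm ((chartAt E c').left_inv hx')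

theorem differentiableAt_chartForm_of_chart {p : ℕ} {α : FormField E M p} {c c' x : M}
    (hx : x ∈ (chartAt E c).source) (hx' : x ∈ (chartAt E c').source)
    (hα : DifferentiableAt ℝ (chartForm c α) (chartAt E c x)) :
    DifferentiableAt ℝ (chartForm c' α) (chartAt E c' x) := by
  have hφ := contDiffAt_coordChange hx hx'
  have hpoint : (chartAt E c ∘ (chartAt E c').symm) (chartAt E c' x) = chartAt E c x := by
    rw [Function.comp_apply, (chartAt E c').left_inv hx']
  refine DifferentiableAt.congr_of_eventuallyEq ?_ (chartForm_eventuallyEq_pullback α hx hx')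
  rw [← hpoint] at hα
  exact (hα.comp _ (hφ.differentiableAt (by simp))).continuousAlternatingMapCompContinuousLinearMap
    ((hφ.fderiv_right (m := 1) (WithTop.coe_le_coe.2 le_top)).differentiableAt (by simp))

theorem minSmoothness_two_le : minSmoothness ℝ 2 ≤ ((⊤ : ℕ∞) : WithTop ℕ∞) := by
  rw [minSmoothness_of_isRCLikeNormedField]
  exact WithTop.coe_le_coe.2 le_top

theorem chartForm_extD {p : ℕ} {α : FormField E M p} {c x : M} (hx : x ∈ (chartAt E c).source)
    (hα : DifferentiableAt ℝ (chartForm c α) (chartAt E c x)) :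
    chartForm c (extD α) (chartAt E c x) = extDeriv (chartForm c α) (chartAt E c x) := by
  have hxx := mem_chart_source E x
  have hpoint : (chartAt E c ∘ (chartAt E x).symm) (chartAt E x x) = chartAt E c x := by
    rw [Function.comp_apply, (chartAt E x).left_inv hxx]
  have hpull := (chartForm_eventuallyEq_pullback α hx hxx).extDeriv_eq
  rw [extDeriv_pullback (by rwa [hpoint]) (contDiffAt_coordChange hx hxx) minSmoothness_two_le,
    hpoint] at hpull
  rw [chartForm_apply_chart hx, extD, hpull]
  ext v
  refine congrArg (extDeriv (chartForm c α) (chartAt E c x)) (funext fun i => ?_)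
  refine (fderiv_coordChange hx hxx _).trans ?_
  exact (congrArg (mfderiv 𝓘(ℝ, E) 𝓘(ℝ, E) (chartAt E c) x) (chartFrame_mfderiv hxx _)).trans
    (mfderiv_chartFrame hx (v i))

theorem differentiableAt_chartForm {p : ℕ} {α : FormField E M p} (hα : IsSmoothForm α) {c x : M}
    (hx : x ∈ (chartAt E c).source) :
    DifferentiableAt ℝ (chartForm c α) (chartAt E c x) :=
  differentiableAt_chartForm_of_chart (mem_chart_source E x) hx (hα.differentiableAt x)

theorem extD_extD {p : ℕ} {α : FormField E M p} (hα : IsSmoothForm α) : extD (extD α) = 0 := by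
  funext x
  have h : chartForm x (extD α) =ᶠ[𝓝 (chartAt E x x)] extDeriv (chartForm x α) :=
    eventually_nhds_chart (mem_chart_source E x)
      fun _ hz => chartForm_extD hz (differentiableAt_chartForm hα hz)
  have hsmooth : ContDiffAt ℝ (⊤ : ℕ∞) (chartForm x α) (chartAt E x x) :=
    (hα x).contDiffAt ((chartAt E x).open_target.mem_nhds (mem_chart_target E x))
  rw [extD, h.extDeriv_eq, extDeriv_extDeriv_apply hsmooth minSmoothness_two_le]
  rfl

theorem dExt_dExt {τ : Forms E M} (hτ : ∀ p, IsSmoothForm (τ p)) : dExt (dExt τ) = 0 := by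
  funext p
  match p with
  | 0 => rfl
  | 1 => exact extD_zero
  | p + 2 => exact extD_extD (hτ p)

end Smooth

end Charts

/-! ### The Lie derivative along a multivector field -/

section LieDerivative

variable {E : Type*} [NormedAddCommGroup E] [NormedSpace ℝ E]
  {M : Type*} [TopologicalSpace M] [ChartedSpace E M]

/-- The components at `x` of an inhomogeneous form, expressed in the chart at `c`. -/
def formInChart (c x : M) : Forms E M →ₗ[ℝ] ∀ p, E [⋀^Fin p]→L[ℝ] ℝ where
  toFun τ p := chartForm c (τ p) (chartAt E c x)
  map_add' _ _ := rfl
  map_smul' _ _ := rfl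

theorem pairing_formInChart {c x : M} (hx : x ∈ (chartAt E c).source) (τ : Forms E M)
    (u : ExteriorAlgebra ℝ E) :
    pairing (formInChart c x τ) u =
      pairing (fun p => τ p x) (ExteriorAlgebra.map (chartFrame c x).toLinearMap u) := by
  rw [← pairing_compContinuousLinearMap (fun p => τ p x)]
  exact congrArg (pairing · u) (funext fun p => chartForm_apply_chart hx (τ p))

/-- The derivative along `v` of the components of an inhomogeneous form in the chart at `c`, taken
at `x`. -/
def formDerivInChart (c x : M) (v : E) (τ : Forms E M) (p : ℕ) : E [⋀^Fin p]→L[ℝ] ℝ :=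
  fderiv ℝ (chartForm c (τ p)) (chartAt E c x) v

/-- The Lie derivative `L_X = [d, X ⌟ ·]` of forms along a `k`-vector field, a graded commutator. -/
def lieDeriv {k : ℕ} (X : MultiField E M k) (τ : Forms E M) : Forms E M :=
  dExt (contract X τ) - (-1 : ℝ) ^ k • contract X (dExt τ)

theorem contDiffOn_chartMulti [FiniteDimensional ℝ E] {k : ℕ} {X : MultiField E M k}
    (hX : X ∈ smoothMulti E M k) (c : M) :
    ContDiffOn ℝ (⊤ : ℕ∞) (chartMulti c X) (chartAt E c).target :=
  contDiffOn_iff_forall_linearMap.2 (hX c)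

theorem differentiableAt_chartMulti [FiniteDimensional ℝ E] {k : ℕ} {X : MultiField E M k}
    (hX : X ∈ smoothMulti E M k) {c x : M} (hx : x ∈ (chartAt E c).source) :
    DifferentiableAt ℝ (chartMulti c X) (chartAt E c x) :=
  ((contDiffOn_chartMulti hX c).contDiffAt ((chartAt E c).open_target.mem_nhds
    ((chartAt E c).map_source hx))).differentiableAt (by simp)

section FirstOrder

variable [IsManifold 𝓘(ℝ, E) 1 M]

theorem eq_of_pairing_formInChart {c x : M} (hx : x ∈ (chartAt E c).source) {α β : Forms E M}
    (h : ∀ u, pairing (formInChart c x α) u = pairing (formInChart c x β) u) (p : ℕ) :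
    α p x = β p x := by
  have hp : (α p x).compContinuousLinearMap (chartFrame c x) =
      (β p x).compContinuousLinearMap (chartFrame c x) := by
    rw [← chartForm_apply_chart hx, ← chartForm_apply_chart hx]
    exact congrFun (pairing_injective (LinearMap.ext h)) p
  ext v
  have hv : v = fun i => chartFrame (E := E) c x
      (mfderiv 𝓘(ℝ, E) 𝓘(ℝ, E) (chartAt E c) x (v i)) :=
    funext fun i => (chartFrame_mfderiv hx (v i)).symm
  rw [hv]
  exact DFunLike.congr_fun hp fun i => mfderiv 𝓘(ℝ, E) 𝓘(ℝ, E) (chartAt E c) x (v i)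

theorem map_chartFrame_chartMulti {k : ℕ} {c x : M} (hx : x ∈ (chartAt E c).source)
    (X : MultiField E M k) :
    ExteriorAlgebra.map (chartFrame c x).toLinearMap (chartMulti c X (chartAt E c x)) =
      (X x : ExteriorAlgebra ℝ (TangentSpace 𝓘(ℝ, E) x)) := by
  have hinv : Function.LeftInverse (chartFrame (E := E) c x).toLinearMap
      (mfderiv 𝓘(ℝ, E) 𝓘(ℝ, E) (chartAt E c) x).toLinearMap := chartFrame_mfderiv hx
  rw [chartMulti_apply_chart hx]
  exact (congrArg (ExteriorAlgebra.map _) (coe_exteriorPower_map _ (X x))).trans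
    (ExteriorAlgebra.leftInverse_map_iff.2 hinv (X x))

theorem pairing_formInChart_contract {k : ℕ} {c x : M} (hx : x ∈ (chartAt E c).source)
    (X : MultiField E M k) (τ : Forms E M) (u : ExteriorAlgebra ℝ E) :
    pairing (formInChart c x (contract X τ)) u =
      pairing (formInChart c x τ) (chartMulti c X (chartAt E c x) * u) := by
  rw [pairing_formInChart hx, pairing_formInChart hx, map_mul, map_chartFrame_chartMulti hx]
  exact pairing_contractAt (X x) (fun p => τ p x) _

theorem chartForm_contract {k : ℕ} (X : MultiField E M k) (τ : Forms E M) {c x : M}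
    (hx : x ∈ (chartAt E c).source) (p : ℕ) :
    chartForm c (contract X τ p) (chartAt E c x) =
      contractAt (chartMulti c X (chartAt E c x)) (chartForm c (τ (k + p)) (chartAt E c x)) := by
  suffices formInChart c x (contract X τ) =
      fun p => contractAt (chartMulti c X (chartAt E c x)) (formInChart c x τ (k + p)) from
    congrFun this p
  refine pairing_injective (LinearMap.ext fun u => ?_)
  rw [pairing_formInChart_contract hx, pairing_contractAt]

theorem eventuallyEq_chartForm_contract {k : ℕ} (X : MultiField E M k) (τ : Forms E M) {c x : M}
    (hx : x ∈ (chartAt E c).source) (p : ℕ) :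
    chartForm c (contract X τ p) =ᶠ[𝓝 (chartAt E c x)]
      fun y => contractAt (chartMulti c X y) (chartForm c (τ (k + p)) y) :=
  eventually_nhds_chart hx fun _ hz => chartForm_contract X τ hz p

variable [FiniteDimensional ℝ E]

theorem isSmoothForm_contract {k : ℕ} {X : MultiField E M k} (hX : X ∈ smoothMulti E M k)
    {τ : Forms E M} (hτ : ∀ p, IsSmoothForm (τ p)) (p : ℕ) : IsSmoothForm (contract X τ p) :=
  fun c => (contDiffOn_bilinear (contractₗ k p) (contDiffOn_chartMulti hX c)
    (hτ (k + p) c)).congr (forall_mem_chart_target fun _ hx => chartForm_contract X τ hx p)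

theorem differentiableAt_chartForm_contract {k : ℕ} {X : MultiField E M k}
    (hX : X ∈ smoothMulti E M k) {τ : Forms E M} {c x : M} (hx : x ∈ (chartAt E c).source)
    (hτ : ∀ p, DifferentiableAt ℝ (chartForm c (τ p)) (chartAt E c x)) (p : ℕ) :
    DifferentiableAt ℝ (chartForm c (contract X τ p)) (chartAt E c x) :=
  (hasFDerivAt_contractAt (differentiableAt_chartMulti hX hx) (hτ (k + p))).differentiableAt
    |>.congr_of_eventuallyEq (eventuallyEq_chartForm_contract X τ hx p)

theorem pairing_formDerivInChart_contract {k : ℕ} {X : MultiField E M k}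
    (hX : X ∈ smoothMulti E M k) {τ : Forms E M} {c x : M} (hx : x ∈ (chartAt E c).source)
    (hτ : ∀ p, DifferentiableAt ℝ (chartForm c (τ p)) (chartAt E c x)) (v : E)
    (u : ExteriorAlgebra ℝ E) :
    pairing (formDerivInChart c x v (contract X τ)) u =
      pairing (formInChart c x τ) (fderiv ℝ (chartMulti c X) (chartAt E c x) v * u) +
        pairing (formDerivInChart c x v τ) (chartMulti c X (chartAt E c x) * u) := by
  rw [← pairing_contractAt, ← pairing_contractAt, ← LinearMap.add_apply, ← map_add]
  refine congrArg (pairing · u) (funext fun p => ?_)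
  rw [formDerivInChart, (eventuallyEq_chartForm_contract X τ hx p).fderiv_eq,
    fderiv_contractAt (differentiableAt_chartMulti hX hx) (hτ (k + p))]
  rfl

end FirstOrder

section Smooth

variable [IsManifold 𝓘(ℝ, E) (⊤ : ℕ∞) M]

theorem pairing_formInChart_dExt {ι : Type*} [Fintype ι] (b : Module.Basis ι ℝ E) {τ : Forms E M}
    {c x : M} (hx : x ∈ (chartAt E c).source)
    (hτ : ∀ p, DifferentiableAt ℝ (chartForm c (τ p)) (chartAt E c x))
    (u : ExteriorAlgebra ℝ E) :
    pairing (formInChart c x (dExt τ)) u =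
      ∑ a, pairing (formDerivInChart c x (b a) τ) (interior (b.coord a) u) :=
  pairing_eq_of_extDeriv b rfl (fun p => chartForm_extD hx (hτ p)) u

variable [FiniteDimensional ℝ E]

theorem pairing_formInChart_lieDeriv {ι : Type*} [Fintype ι] (b : Module.Basis ι ℝ E) {k : ℕ}
    {X : MultiField E M k} (hX : X ∈ smoothMulti E M k) {τ : Forms E M} {c x : M}
    (hx : x ∈ (chartAt E c).source)
    (hτ : ∀ p, DifferentiableAt ℝ (chartForm c (τ p)) (chartAt E c x))
    (u : ExteriorAlgebra ℝ E) :
    pairing (formInChart c x (lieDeriv X τ)) u =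
      ∑ a, (pairing (formInChart c x τ)
          (fderiv ℝ (chartMulti c X) (chartAt E c x) (b a) * interior (b.coord a) u) -
        (-1 : ℝ) ^ k • pairing (formDerivInChart c x (b a) τ)
          (interior (b.coord a) (chartMulti c X (chartAt E c x)) * u)) := by
  rw [lieDeriv, map_sub, map_smul, map_sub, map_smul, LinearMap.sub_apply, LinearMap.smul_apply,
    pairing_formInChart_contract hx, pairing_formInChart_dExt b hx hτ,
    pairing_formInChart_dExt b hx (differentiableAt_chartForm_contract hX hx hτ),
    Finset.smul_sum, ← Finset.sum_sub_distrib]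
  refine Finset.sum_congr rfl fun a _ => ?_
  rw [pairing_formDerivInChart_contract hX hx hτ,
    interior_mul_of_mem _ (chartMulti c X (chartAt E c x)).2, map_add, map_smul, smul_add,
    smul_smul, ← mul_pow, neg_one_mul, neg_neg, one_pow, one_smul]
  abel

theorem pairing_formInChart_lieDeriv_comm {k l : ℕ} {X : MultiField E M (k + 1)}
    {Y : MultiField E M (l + 1)} (hX : X ∈ smoothMulti E M (k + 1))
    (hY : Y ∈ smoothMulti E M (l + 1)) {τ : Forms E M} {c x : M} (hx : x ∈ (chartAt E c).source)
    (hτ : ∀ p, DifferentiableAt ℝ (chartForm c (τ p)) (chartAt E c x))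
    (u : ExteriorAlgebra ℝ E) :
    pairing (formInChart c x ((-1 : ℝ) ^ (k * (l + 1)) • lieDeriv X (contract Y τ) -
        contract Y (lieDeriv X τ))) u =
      pairing (formInChart c x τ)
        (localSchouten (chartMulti c X) (chartMulti c Y) (chartAt E c x) * u) := by
  set b := Module.finBasis ℝ E with hb
  rw [map_sub, map_smul, map_sub, map_smul, LinearMap.sub_apply, LinearMap.smul_apply,
    pairing_formInChart_contract hx, pairing_formInChart_lieDeriv b hX hx hτ,
    pairing_formInChart_lieDeriv b hX hx (differentiableAt_chartForm_contract hY hx hτ),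
    Finset.smul_sum, ← Finset.sum_sub_distrib]
  simp only [pairing_formInChart_contract hx, pairing_formDerivInChart_contract hY hx hτ]
  rw [localSchouten, Submodule.coe_sub, Submodule.coe_smul, coe_wedgeInterior, coe_wedgeInterior,
    ← hb, Finset.smul_sum, ← Finset.sum_sub_distrib, Finset.sum_mul, map_sum]
  refine Finset.sum_congr rfl fun a _ => ?_
  have hYX := mul_comm_of_mem (fderiv ℝ (chartMulti c X) (chartAt E c x) (b a)).2
    (chartMulti c Y (chartAt E c x)).2
  have hYiX := mul_comm_of_mem (interior_mem (b.coord a) (chartMulti c X (chartAt E c x)).2)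
    (chartMulti c Y (chartAt E c x)).2
  rw [interior_mul_of_mem _ (chartMulti c Y (chartAt E c x)).2]
  simp only [mul_add, ← mul_assoc, mul_smul_comm, hYX, hYiX, smul_mul_assoc, sub_mul, map_add,
    map_sub, map_smul, smul_sub, smul_add, smul_smul, ← pow_add]
  have hsign₁ : (-1 : ℝ) ^ (l + 1 + ((k + 1) * l + (k + 1) * 1)) = (-1) ^ (k * l + k * 1) :=
    neg_one_pow_congr (by grind)
  have hsign₂ : (-1 : ℝ) ^ (k * l + k * 1 + (k + 1)) = -(-1) ^ (k * l) :=
    neg_one_pow_eq_neg_of_even_iff_odd (by grind)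
  rw [hsign₁, add_comm (k + 1), hsign₂]
  module

end Smooth

end LieDerivative

/-! ### The Schouten bracket -/

section Schouten

variable {E : Type*} [NormedAddCommGroup E] [NormedSpace ℝ E]
  {M : Type*} [TopologicalSpace M] [ChartedSpace E M]

/-- The form whose components in the chart at `c` are the constants `η p`. -/
def constForm (c : M) (η : ∀ p, E [⋀^Fin p]→L[ℝ] ℝ) : Forms E M :=
  fun p x => (η p).compContinuousLinearMap (mfderiv 𝓘(ℝ, E) 𝓘(ℝ, E) (chartAt E c) x)

theorem chartForm_constForm [IsManifold 𝓘(ℝ, E) 1 M] {c x : M} (hx : x ∈ (chartAt E c).source)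
    (η : ∀ p, E [⋀^Fin p]→L[ℝ] ℝ) (p : ℕ) :
    chartForm c (constForm c η p) (chartAt E c x) = η p := by
  rw [chartForm_apply_chart hx]
  ext v
  exact congrArg (η p) (funext fun i => mfderiv_chartFrame hx (v i))

theorem differentiableAt_chartForm_constForm [IsManifold 𝓘(ℝ, E) 1 M] {c x : M}
    (hx : x ∈ (chartAt E c).source) (η : ∀ p, E [⋀^Fin p]→L[ℝ] ℝ) (p : ℕ) :
    DifferentiableAt ℝ (chartForm c (constForm c η p)) (chartAt E c x) :=
  (differentiableAt_const (η p)).congr_of_eventuallyEq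
    (eventually_nhds_chart hx fun _ hz => chartForm_constForm hz η p)

theorem formInChart_congr {c x : M} (hx : x ∈ (chartAt E c).source) {α β : Forms E M}
    (h : ∀ p, α p x = β p x) : formInChart c x α = formInChart c x β := by
  funext p
  exact (chartForm_apply_chart hx (α p)).trans
    (h p ▸ (chartForm_apply_chart hx (β p)).symm)

variable [FiniteDimensional ℝ E]

/-- The Schouten bracket of multivector fields `X` of degree `k + 1` and `Y` of degree `l + 1`,
computed at `x` in the chart at `x`. -/
def schouten {k l : ℕ} (X : MultiField E M (k + 1)) (Y : MultiField E M (l + 1)) :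
    MultiField E M (k + l + 1) := fun x =>
  exteriorPower.map _ (chartFrame x x).toLinearMap
    (localSchouten (chartMulti x X) (chartMulti x Y) (chartAt E x x))

theorem chartMulti_schouten_self [IsManifold 𝓘(ℝ, E) 1 M] {k l : ℕ} (X : MultiField E M (k + 1))
    (Y : MultiField E M (l + 1)) (x : M) :
    chartMulti x (schouten X Y) (chartAt E x x) =
      localSchouten (chartMulti x X) (chartMulti x Y) (chartAt E x x) := by
  have hxx := mem_chart_source E x
  let D : TangentSpace 𝓘(ℝ, E) x →L[ℝ] E := mfderiv 𝓘(ℝ, E) 𝓘(ℝ, E) (chartAt E x) x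
  have hinv : Function.LeftInverse D.toLinearMap (chartFrame (E := E) x x).toLinearMap :=
    mfderiv_chartFrame hxx
  rw [chartMulti_apply_chart hxx]
  refine Subtype.ext ((coe_exteriorPower_map _ _).trans ?_)
  exact (congrArg (ExteriorAlgebra.map _) (coe_exteriorPower_map _ _)).trans
    (ExteriorAlgebra.leftInverse_map_iff.2 hinv _)

variable [IsManifold 𝓘(ℝ, E) (⊤ : ℕ∞) M]

theorem contract_schouten_apply {k l : ℕ} {X : MultiField E M (k + 1)} {Y : MultiField E M (l + 1)}
    (hX : X ∈ smoothMulti E M (k + 1)) (hY : Y ∈ smoothMulti E M (l + 1)) {τ : Forms E M} {x : M}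
    (hτ : ∀ p, DifferentiableAt ℝ (chartForm x (τ p)) (chartAt E x x)) (p : ℕ) :
    contract (schouten X Y) τ p x =
      ((-1 : ℝ) ^ (k * (l + 1)) • lieDeriv X (contract Y τ) - contract Y (lieDeriv X τ)) p x := by
  have hxx := mem_chart_source E x
  refine eq_of_pairing_formInChart hxx (fun u => ?_) p
  rw [pairing_formInChart_contract hxx, chartMulti_schouten_self,
    pairing_formInChart_lieDeriv_comm hX hY hxx hτ]

theorem contract_schouten {k l : ℕ} {X : MultiField E M (k + 1)} {Y : MultiField E M (l + 1)}
    (hX : X ∈ smoothMulti E M (k + 1)) (hY : Y ∈ smoothMulti E M (l + 1)) {τ : Forms E M}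
    (hτ : ∀ p, IsSmoothForm (τ p)) :
    contract (schouten X Y) τ =
      (-1 : ℝ) ^ (k * (l + 1)) • lieDeriv X (contract Y τ) - contract Y (lieDeriv X τ) :=
  funext fun p => funext fun x =>
    contract_schouten_apply hX hY (fun p => (hτ p).differentiableAt x) p

-- Both sides are determined by the action of the commutator of `L_X` and `Y ⌟ ·` on forms.
theorem chartMulti_schouten {k l : ℕ} {X : MultiField E M (k + 1)} {Y : MultiField E M (l + 1)}
    (hX : X ∈ smoothMulti E M (k + 1)) (hY : Y ∈ smoothMulti E M (l + 1)) {c x : M}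
    (hx : x ∈ (chartAt E c).source) :
    chartMulti c (schouten X Y) (chartAt E c x) =
      localSchouten (chartMulti c X) (chartMulti c Y) (chartAt E c x) := by
  refine exteriorPower_ext_pairing fun η => ?_
  have hη : formInChart c x (constForm c η) = η := funext (chartForm_constForm hx η)
  have hdiff := differentiableAt_chartForm_constForm hx η
  have hcomm := contract_schouten_apply hX hY
    fun p => differentiableAt_chartForm_of_chart hx (mem_chart_source E x) (hdiff p)
  have h := pairing_formInChart_lieDeriv_comm hX hY hx hdiff 1
  rw [← formInChart_congr hx hcomm, pairing_formInChart_contract hx] at h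
  simpa only [mul_one, hη] using h

theorem schouten_mem_smoothMulti {k l : ℕ} {X : MultiField E M (k + 1)}
    {Y : MultiField E M (l + 1)} (hX : X ∈ smoothMulti E M (k + 1))
    (hY : Y ∈ smoothMulti E M (l + 1)) : schouten X Y ∈ smoothMulti E M (k + l + 1) :=
  fun c => contDiffOn_iff_forall_linearMap.1 <|
    (contDiffOn_localSchouten (chartAt E c).open_target (by simp) (contDiffOn_chartMulti hX c)
      (contDiffOn_chartMulti hY c)).congr <|
    forall_mem_chart_target fun _ hx => chartMulti_schouten hX hY hx

end Schouten

/-! ### Hamiltonian forms and their Poisson bracket -/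

theorem neg_one_pow_hamGrade_mul (i j : ℕ) :
    (-1 : ℝ) ^ (hamGrade (i + 1) * hamGrade (j + 1)) = (-1) ^ (i * j) :=
  neg_one_pow_congr (by grind [hamGrade])

section Contraction

variable {E : Type*} [NormedAddCommGroup E] [NormedSpace ℝ E]
  {M : Type*} [TopologicalSpace M] [ChartedSpace E M]

theorem contract_add_right {k : ℕ} (X : MultiField E M k) (α β : Forms E M) :
    contract X (α + β) = contract X α + contract X β :=
  funext fun _ => funext fun x => contractAt_add_right (X x) _ _

theorem contract_smul_right {k : ℕ} (X : MultiField E M k) (r : ℝ) (α : Forms E M) :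
    contract X (r • α) = r • contract X α :=
  funext fun _ => funext fun x => contractAt_smul_right r (X x) _

theorem contract_zero_right {k : ℕ} (X : MultiField E M k) : contract X (0 : Forms E M) = 0 := by
  simpa using contract_smul_right X 0 0

theorem contract_neg_right {k : ℕ} (X : MultiField E M k) (α : Forms E M) :
    contract X (-α) = -contract X α := by
  simpa using contract_smul_right X (-1) α

theorem contract_comm {k l : ℕ} (X : MultiField E M k) (Y : MultiField E M l) (τ : Forms E M) :
    contract X (contract Y τ) = (-1 : ℝ) ^ (k * l) • contract Y (contract X τ) := by
  suffices ∀ x, (fun p => contract X (contract Y τ) p x) =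
      (-1 : ℝ) ^ (k * l) • fun p => contract Y (contract X τ) p x from
    funext fun p => funext fun x => congrFun (this x) p
  refine fun x => pairing_injective (LinearMap.ext fun u => ?_)
  have pairing_contract {j : ℕ} (Z : MultiField E M j) (σ : Forms E M) u :
      pairing (fun p => contract Z σ p x) u = pairing (fun p => σ p x) (Z x * u) :=
    pairing_contractAt (Z x) (fun p => σ p x) u
  rw [map_smul, LinearMap.smul_apply, pairing_contract, pairing_contract, pairing_contract,
    pairing_contract, ← mul_assoc, ← mul_assoc, mul_comm_of_mem (Y x).2 (X x).2,
    smul_mul_assoc, map_smul, mul_comm l k]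

theorem contract_mem_Omega [FiniteDimensional ℝ E] [IsManifold 𝓘(ℝ, E) 1 M] {k : ℕ}
    {X : MultiField E M k} (hX : X ∈ smoothMulti E M k) {j : ℤ} {τ : Forms E M}
    (hτ : τ ∈ Omega E M j) : contract X τ ∈ Omega E M (j - k) := by
  refine ⟨isSmoothForm_contract hX hτ.1, fun p hp => funext fun x => ?_⟩
  have hzero : τ (k + p) = 0 := hτ.2 (k + p) (by push_cast; omega)
  rw [contract, hzero]
  exact congrFun (congrFun (contract_zero_right X) p) x

end Contraction

section Hamiltonian

variable {E : Type*} [NormedAddCommGroup E] [NormedSpace ℝ E]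
  {M : Type*} [TopologicalSpace M] [ChartedSpace E M] {ω α β γ : Forms E M}

section Bracket

variable {k l : ℕ} {X X' : MultiField E M k} {Y : MultiField E M l}

theorem IsHamiltonianField.contract_eq (hX : IsHamiltonianField ω α X) :
    contract X ω = -dExt α := by
  rw [hX.2, neg_neg]

theorem IsHamiltonianField.contract_congr (hX : IsHamiltonianField ω α X)
    (hX' : IsHamiltonianField ω α X') : contract X ω = contract X' ω :=
  hX.contract_eq.trans hX'.contract_eq.symm

theorem IsHamiltonianField.smul (hX : IsHamiltonianField ω α X) (r : ℝ) :
    IsHamiltonianField ω (r • α) (r • X) :=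
  ⟨Submodule.smul_mem _ r hX.1, by rw [dExt_smul, hX.2, contract_smul, smul_neg]⟩

theorem isHamiltonianField_hamField (hX : IsHamiltonianField ω α X) :
    IsHamiltonianField ω α (hamField ω k α) := by
  have h : ∃ X : MultiField E M k, IsHamiltonianField ω α X := ⟨X, hX⟩
  rw [hamField, dif_pos h]
  exact h.choose_spec

theorem poisson_eq (hX : IsHamiltonianField ω α X) (hY : IsHamiltonianField ω β Y) :
    poisson ω k l α β = (-1 : ℝ) ^ hamGrade l • contract Y (contract X ω) := by
  rw [poisson, (isHamiltonianField_hamField hX).contract_congr hX, contract_comm,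
    (isHamiltonianField_hamField hY).contract_congr hY, ← contract_comm]

theorem poisson_skew (hX : IsHamiltonianField ω α X) (hY : IsHamiltonianField ω β Y) :
    poisson ω k l α β = -((-1 : ℝ) ^ (hamGrade k * hamGrade l) • poisson ω l k β α) := by
  rw [poisson_eq hX hY, poisson_eq hY hX, contract_comm, smul_smul, smul_smul, ← pow_add,
    ← pow_add, ← neg_smul]
  exact congrArg (· • _) (neg_one_pow_eq_neg_of_even_iff_odd (by grind [hamGrade]))

end Bracket

section Linearity

variable {n k l : ℕ} {α α' β β' : Forms E M}

theorem IsHamiltonianField.add {i j : ℤ} (hα : α ∈ Omega E M i) (hα' : α' ∈ Omega E M j)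
    {X X' : MultiField E M k} (hX : IsHamiltonianField ω α X) (hX' : IsHamiltonianField ω α' X') :
    IsHamiltonianField ω (α + α') (X + X') :=
  ⟨Submodule.add_mem _ hX.1 hX'.1, by
    rw [dExt_add hα hα', hX.2, hX'.2, contract_add, neg_add]⟩

theorem poisson_add_left (hα : α ∈ HamForms n ω k) (hα' : α' ∈ HamForms n ω k)
    (hβ : β ∈ HamForms n ω l) :
    poisson ω k l (α + α') β = poisson ω k l α β + poisson ω k l α' β := by
  obtain ⟨hα, X, hX⟩ := hα
  obtain ⟨hα', X', hX'⟩ := hα'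
  obtain ⟨-, Y, hY⟩ := hβ
  rw [poisson_eq (hX.add hα hα' hX') hY, poisson_eq hX hY, poisson_eq hX' hY, contract_add,
    contract_add_right, smul_add]

theorem poisson_smul_left (hα : α ∈ HamForms n ω k) (hβ : β ∈ HamForms n ω l) (r : ℝ) :
    poisson ω k l (r • α) β = r • poisson ω k l α β := by
  obtain ⟨-, X, hX⟩ := hα
  obtain ⟨-, Y, hY⟩ := hβ
  rw [poisson_eq (hX.smul r) hY, poisson_eq hX hY, contract_smul, contract_smul_right, smul_comm]

theorem poisson_add_right (hα : α ∈ HamForms n ω k) (hβ : β ∈ HamForms n ω l)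
    (hβ' : β' ∈ HamForms n ω l) :
    poisson ω k l α (β + β') = poisson ω k l α β + poisson ω k l α β' := by
  obtain ⟨X, hX⟩ := hα.2
  obtain ⟨Y, hY⟩ := hβ.2
  obtain ⟨Y', hY'⟩ := hβ'.2
  rw [poisson_skew hX (hY.add hβ.1 hβ'.1 hY'), poisson_skew hX hY, poisson_skew hX hY',
    poisson_add_left hβ hβ' hα, smul_add, neg_add]

theorem poisson_smul_right (hα : α ∈ HamForms n ω k) (hβ : β ∈ HamForms n ω l) (r : ℝ) :
    poisson ω k l α (r • β) = r • poisson ω k l α β := by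
  obtain ⟨X, hX⟩ := hα.2
  obtain ⟨Y, hY⟩ := hβ.2
  rw [poisson_skew hX (hY.smul r), poisson_skew hX hY, poisson_smul_left hβ hα, smul_comm,
    smul_neg]

theorem poisson_eq_zero_of_closed_left (hα : α ∈ HamForms n ω k) (h : dExt α = 0) :
    poisson ω k l α β = 0 := by
  obtain ⟨-, X, hX⟩ := hα
  rw [poisson, (isHamiltonianField_hamField hX).contract_eq, h, neg_zero, contract_zero_right,
    smul_zero]

theorem poisson_eq_zero_of_closed_right (hα : α ∈ HamForms n ω k) (hβ : β ∈ HamForms n ω l)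
    (h : dExt β = 0) : poisson ω k l α β = 0 := by
  obtain ⟨X, hX⟩ := hα.2
  obtain ⟨Y, hY⟩ := hβ.2
  rw [poisson_skew hX hY, poisson_eq_zero_of_closed_left hβ h, smul_zero, neg_zero]

end Linearity

section DirectSum

variable {n : ℕ}

theorem lof_mk_congr {i j : ℕ} (hij : i = j) {α : HamForms n ω (i + 1)}
    {β : HamForms n ω (j + 1)} (hαβ : (α : Forms E M) = β) :
    DirectSum.lof ℝ ℕ (HamQuot n ω) i (Submodule.Quotient.mk α) =
      DirectSum.lof ℝ ℕ (HamQuot n ω) j (Submodule.Quotient.mk β) := by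
  subst hij
  rw [Subtype.ext hαβ]

theorem lof_add_lof_add_lof_eq_zero_of_closed {i j k : ℕ} (hij : i = j) (hik : i = k)
    {α : HamForms n ω (i + 1)} {β : HamForms n ω (j + 1)} {γ : HamForms n ω (k + 1)} {r s t : ℝ}
    (hclosed : dExt (r • (α : Forms E M) + s • (β : Forms E M) + t • (γ : Forms E M)) = 0) :
    r • DirectSum.lof ℝ ℕ (HamQuot n ω) i (Submodule.Quotient.mk α) +
      s • DirectSum.lof ℝ ℕ (HamQuot n ω) j (Submodule.Quotient.mk β) +
      t • DirectSum.lof ℝ ℕ (HamQuot n ω) k (Submodule.Quotient.mk γ) = 0 := by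
  subst hij hik
  have hmk : (Submodule.Quotient.mk (r • α + s • β + t • γ) : HamQuot n ω i) = 0 :=
    (Submodule.Quotient.mk_eq_zero _).2 hclosed
  simpa using congrArg (DirectSum.lof ℝ ℕ (HamQuot n ω) i) hmk

end DirectSum

variable [IsManifold 𝓘(ℝ, E) (⊤ : ℕ∞) M]

theorem IsHamiltonianField.dExt_contract {k : ℕ} {X : MultiField E M k}
    (hX : IsHamiltonianField ω α X) (hα : ∀ p, IsSmoothForm (α p)) :
    dExt (contract X ω) = 0 := by
  rw [hX.contract_eq, ← neg_one_smul ℝ (dExt α), dExt_smul, dExt_dExt hα, smul_zero]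

variable [FiniteDimensional ℝ E] {k l m : ℕ} {X : MultiField E M (k + 1)}
  {Y : MultiField E M (l + 1)} {Z : MultiField E M (m + 1)}

theorem dExt_contract_contract (hω : ∀ p, IsSmoothForm (ω p)) (hdω : dExt ω = 0)
    (hX : X ∈ smoothMulti E M (k + 1)) (hY : Y ∈ smoothMulti E M (l + 1))
    (hdX : dExt (contract X ω) = 0) (hdY : dExt (contract Y ω) = 0) :
    dExt (contract X (contract Y ω)) =
      (-1 : ℝ) ^ (k * (l + 1)) • contract (schouten X Y) ω := by
  rw [contract_schouten hX hY hω, lieDeriv, lieDeriv, hdX, hdY, hdω]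
  simp [contract_zero_right, smul_smul, ← mul_pow]

theorem contract_schouten_swap (hω : ∀ p, IsSmoothForm (ω p)) (hdω : dExt ω = 0)
    (hX : X ∈ smoothMulti E M (k + 1)) (hY : Y ∈ smoothMulti E M (l + 1))
    (hdX : dExt (contract X ω) = 0) (hdY : dExt (contract Y ω) = 0) :
    contract (schouten X Y) ω = -((-1 : ℝ) ^ (k * l) • contract (schouten Y X) ω) := by
  have hXY := dExt_contract_contract hω hdω hX hY hdX hdY
  rw [contract_comm, dExt_smul, dExt_contract_contract hω hdω hY hX hdY hdX, smul_smul,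
    ← pow_add] at hXY
  rw [neg_one_pow_smul_eq_iff.1 hXY.symm, smul_smul, ← pow_add, ← neg_smul]
  exact congrArg (· • _) (neg_one_pow_eq_neg_of_even_iff_odd (by grind))

-- The Leibniz rule: `L_X` acts on `Y ⌟ Z ⌟ ω`, and on each factor by the Schouten bracket.
theorem dExt_contract_contract_contract (hω : ∀ p, IsSmoothForm (ω p)) (hdω : dExt ω = 0)
    (hX : X ∈ smoothMulti E M (k + 1)) (hY : Y ∈ smoothMulti E M (l + 1))
    (hZ : Z ∈ smoothMulti E M (m + 1)) (hdX : dExt (contract X ω) = 0)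
    (hdY : dExt (contract Y ω) = 0) (hdZ : dExt (contract Z ω) = 0) :
    dExt (contract X (contract Y (contract Z ω))) =
      -((-1 : ℝ) ^ (k + l * (m + 1)) • contract X (contract (schouten Y Z) ω) +
        (-1 : ℝ) ^ (k * l) • contract Y (contract (schouten Z X) ω) +
        (-1 : ℝ) ^ (k * l + l * m + m * k + l + m) • contract Z (contract (schouten X Y) ω)) := by
  have hXYZ := contract_schouten hX hY (isSmoothForm_contract hZ hω)
  rw [lieDeriv, lieDeriv, hdZ, contract_zero_right, smul_zero, sub_zero,
    dExt_contract_contract hω hdω hX hZ hdX hdZ, dExt_contract_contract hω hdω hY hZ hdY hdZ,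
    contract_schouten_swap hω hdω hX hZ hdX hdZ, contract_comm, eq_sub_iff_add_eq, eq_comm,
    neg_one_pow_smul_eq_iff, sub_eq_iff_eq_add] at hXYZ
  rw [hXYZ]
  simp only [contract_smul_right, contract_neg_right, smul_add, smul_neg, smul_smul, ← pow_add]
  have hsignX : (-1 : ℝ) ^ (k + 1 + l * (m + 1)) = -(-1) ^ (k + l * (m + 1)) :=
    neg_one_pow_eq_neg_of_even_iff_odd (by grind)
  have hsignY : (-1 : ℝ) ^ (k * (l + 1) + (k * (m + 1) + k * m)) = (-1) ^ (k * l) :=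
    neg_one_pow_congr (by grind)
  have hsignZ : (-1 : ℝ) ^ (k * (l + 1) + (k + l + 1) * (m + 1)) =
      -(-1) ^ (k * l + l * m + m * k + l + m) := neg_one_pow_eq_neg_of_even_iff_odd (by grind)
  rw [hsignX, hsignY, hsignZ]
  module

theorem IsHamiltonianField.schouten (hω : ∀ p, IsSmoothForm (ω p)) (hdω : dExt ω = 0)
    (hα : ∀ p, IsSmoothForm (α p)) (hβ : ∀ p, IsSmoothForm (β p))
    (hX : IsHamiltonianField ω α X) (hY : IsHamiltonianField ω β Y) :
    IsHamiltonianField ω (poisson ω (k + 1) (l + 1) α β) (schouten X Y) := by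
  refine ⟨schouten_mem_smoothMulti hX.1 hY.1, ?_⟩
  rw [poisson_eq hX hY, contract_comm, smul_smul, ← pow_add, dExt_smul,
    dExt_contract_contract hω hdω hX.1 hY.1 (hX.dExt_contract hα) (hY.dExt_contract hβ),
    smul_smul, ← pow_add, neg_one_pow_eq_neg_of_even_iff_odd (n := 0) (by grind [hamGrade]),
    pow_zero, neg_one_smul]

theorem poisson_poisson (hω : ∀ p, IsSmoothForm (ω p)) (hdω : dExt ω = 0)
    (hβ : ∀ p, IsSmoothForm (β p)) (hγ : ∀ p, IsSmoothForm (γ p))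
    (hX : IsHamiltonianField ω α X) (hY : IsHamiltonianField ω β Y)
    (hZ : IsHamiltonianField ω γ Z) :
    poisson ω (k + 1) (l + m + 1) α (poisson ω (l + 1) (m + 1) β γ) =
      -((-1 : ℝ) ^ (k * (l + m + 1)) • contract X (contract (schouten Y Z) ω)) := by
  rw [poisson_eq hX (hY.schouten hω hdω hβ hγ hZ), contract_comm, smul_smul, ← pow_add, ← neg_smul]
  exact congrArg (· • _) (neg_one_pow_eq_neg_of_even_iff_odd (by grind [hamGrade]))

theorem poisson_jacobi (hω : ∀ p, IsSmoothForm (ω p)) (hdω : dExt ω = 0)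
    (hα : ∀ p, IsSmoothForm (α p)) (hβ : ∀ p, IsSmoothForm (β p)) (hγ : ∀ p, IsSmoothForm (γ p))
    (hX : IsHamiltonianField ω α X) (hY : IsHamiltonianField ω β Y)
    (hZ : IsHamiltonianField ω γ Z) :
    (-1 : ℝ) ^ (hamGrade (k + 1) * hamGrade (m + 1)) •
        poisson ω (k + 1) (l + m + 1) α (poisson ω (l + 1) (m + 1) β γ) +
      (-1 : ℝ) ^ (hamGrade (l + 1) * hamGrade (k + 1)) •
        poisson ω (l + 1) (m + k + 1) β (poisson ω (m + 1) (k + 1) γ α) +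
      (-1 : ℝ) ^ (hamGrade (m + 1) * hamGrade (l + 1)) •
        poisson ω (m + 1) (k + l + 1) γ (poisson ω (k + 1) (l + 1) α β) =
    (-1 : ℝ) ^ (hamGrade (l + 1) * hamGrade (m + 1) + hamGrade (l + 1) * hamGrade (k + 1) +
        hamGrade (l + 1)) • dExt (contract X (contract Y (contract Z ω))) := by
  rw [poisson_poisson hω hdω hβ hγ hX hY hZ, poisson_poisson hω hdω hγ hα hY hZ hX,
    poisson_poisson hω hdω hα hβ hZ hX hY, dExt_contract_contract_contract hω hdω hX.1 hY.1 hZ.1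
      (hX.dExt_contract hα) (hY.dExt_contract hβ) (hZ.dExt_contract hγ)]
  simp only [smul_neg, smul_add, smul_smul, neg_add, ← pow_add]
  refine congrArg₂ _ (congrArg₂ _ ?_ ?_) ?_ <;>
    exact congrArg (fun r : ℝ => -(r • _)) (neg_one_pow_congr (by grind [hamGrade]))

section Quotient

variable {n : ℕ}

theorem poisson_mem_hamForms (hω : ω ∈ Omega E M (n + 1)) (hdω : dExt ω = 0)
    (hα : α ∈ HamForms n ω (k + 1)) (hβ : β ∈ HamForms n ω (l + 1)) :
    poisson ω (k + 1) (l + 1) α β ∈ HamForms n ω (k + l + 1) := by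
  obtain ⟨hα, X, hX⟩ := hα
  obtain ⟨hβ, Y, hY⟩ := hβ
  refine ⟨?_, schouten X Y, hX.schouten hω.1 hdω hα.1 hβ.1 hY⟩
  rw [poisson_eq hX hY]
  have hdeg : (n : ℤ) - (k + l + 1 : ℕ) = n + 1 - (k + 1 : ℕ) - (l + 1 : ℕ) := by
    push_cast
    ring
  exact hdeg ▸ Submodule.smul_mem _ _ (contract_mem_Omega hY.1 (contract_mem_Omega hX.1 hω))

/-- The Poisson bracket of Hamiltonian forms, as a bilinear map. -/
def hamBracket (hω : ω ∈ Omega E M (n + 1)) (hdω : dExt ω = 0) (i j : ℕ) :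
    HamForms n ω (i + 1) →ₗ[ℝ] HamForms n ω (j + 1) →ₗ[ℝ] HamForms n ω (i + j + 1) :=
  LinearMap.mk₂ ℝ
    (fun α β => ⟨poisson ω (i + 1) (j + 1) α β, poisson_mem_hamForms hω hdω α.2 β.2⟩)
    (fun α α' β => Subtype.ext (poisson_add_left α.2 α'.2 β.2))
    (fun r α β => Subtype.ext (poisson_smul_left α.2 β.2 r))
    (fun α β β' => Subtype.ext (poisson_add_right α.2 β.2 β'.2))
    (fun r α β => Subtype.ext (poisson_smul_right α.2 β.2 r))

/-- The bracket induced by `hamBracket` on Hamiltonian forms modulo closed forms. -/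
def quotBracket (hω : ω ∈ Omega E M (n + 1)) (hdω : dExt ω = 0) (i j : ℕ) :
    HamQuot n ω i →ₗ[ℝ] HamQuot n ω j →ₗ[ℝ] HamQuot n ω (i + j) :=
  ((hamBracket hω hdω i j).compr₂ (closedHam n ω (i + j + 1)).mkQ).liftQ₂
    (closedHam n ω (i + 1)) (closedHam n ω (j + 1))
    (fun α hα => LinearMap.ext fun β => by
      have h : hamBracket hω hdω i j α β = 0 :=
        Subtype.ext (poisson_eq_zero_of_closed_left α.2 hα)
      rw [LinearMap.compr₂_apply, h, map_zero, LinearMap.zero_apply])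
    (fun β hβ => LinearMap.ext fun α => by
      have h : hamBracket hω hdω i j α β = 0 :=
        Subtype.ext (poisson_eq_zero_of_closed_right α.2 β.2 hβ)
      rw [LinearMap.flip_apply, LinearMap.compr₂_apply, h, map_zero, LinearMap.zero_apply])

theorem quotBracket_mk (hω : ω ∈ Omega E M (n + 1)) (hdω : dExt ω = 0) (i j : ℕ)
    (α : HamForms n ω (i + 1)) (β : HamForms n ω (j + 1)) :
    quotBracket hω hdω i j (Submodule.Quotient.mk α) (Submodule.Quotient.mk β) =
      Submodule.Quotient.mk ⟨poisson ω (i + 1) (j + 1) α β,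
        poisson_mem_hamForms hω hdω α.2 β.2⟩ := rfl

theorem isGradedLieBracket_quotBracket (hω : ω ∈ Omega E M (n + 1)) (hdω : dExt ω = 0) :
    IsGradedLieBracket (HamQuot n ω) (quotBracket hω hdω) where
  skew i j x y := by
    obtain ⟨α, rfl⟩ := Submodule.Quotient.mk_surjective _ x
    obtain ⟨β, rfl⟩ := Submodule.Quotient.mk_surjective _ y
    obtain ⟨-, X, hX⟩ := α.2
    obtain ⟨-, Y, hY⟩ := β.2
    rw [quotBracket_mk, quotBracket_mk, ← map_smul, ← map_neg, ← Submodule.Quotient.mk_smul,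
      ← Submodule.Quotient.mk_neg]
    refine lof_mk_congr (add_comm i j) ((poisson_skew hX hY).trans ?_)
    rw [neg_one_pow_hamGrade_mul]
    rfl
  jacobi i j k x y z := by
    obtain ⟨α, rfl⟩ := Submodule.Quotient.mk_surjective _ x
    obtain ⟨β, rfl⟩ := Submodule.Quotient.mk_surjective _ y
    obtain ⟨γ, rfl⟩ := Submodule.Quotient.mk_surjective _ z
    obtain ⟨hα, X, hX⟩ := α.2
    obtain ⟨hβ, Y, hY⟩ := β.2
    obtain ⟨hγ, Z, hZ⟩ := γ.2
    have hjac := poisson_jacobi hω.1 hdω hα.1 hβ.1 hγ.1 hX hY hZ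
    have hsmooth := isSmoothForm_contract hX.1
      (isSmoothForm_contract hY.1 (isSmoothForm_contract hZ.1 hω.1))
    simp only [neg_one_pow_hamGrade_mul] at hjac
    simp only [quotBracket_mk]
    refine lof_add_lof_add_lof_eq_zero_of_closed (by omega) (by omega)
      ((congrArg dExt hjac).trans ?_)
    rw [dExt_smul, dExt_dExt hsmooth, smul_zero]

end Quotient

end Hamiltonian

end Multisymplectic

end

theorem mainTheorem8_general {E : Type*} [NormedAddCommGroup E] [NormedSpace ℝ E]
    [FiniteDimensional ℝ E] {M : Type*} [TopologicalSpace M] [ChartedSpace E M]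
    [IsManifold 𝓘(ℝ, E) (⊤ : ℕ∞) M] (n : ℕ) (ω : Forms E M) (hω : ω ∈ Omega E M (n + 1))
    (hdω : dExt ω = 0) :
    (∀ k l : ℕ, 1 ≤ k → 1 ≤ l → ∀ α ∈ HamForms n ω k, ∀ β ∈ HamForms n ω l,
      (∀ (X : MultiField E M k) (Y : MultiField E M l),
        IsHamiltonianField ω α X → IsHamiltonianField ω β Y →
          poisson ω k l α β = (-1 : ℝ) ^ hamGrade l • contract Y (contract X ω)) ∧
      poisson ω k l α β ∈ HamForms n ω (k + l - 1)) ∧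
    (∀ k l : ℕ, 1 ≤ k → 1 ≤ l → ∀ α ∈ HamForms n ω k, ∀ β ∈ HamForms n ω l,
      poisson ω k l α β = -((-1 : ℝ) ^ (hamGrade k * hamGrade l) • poisson ω l k β α)) ∧
    (∀ k l m : ℕ, 1 ≤ k → 1 ≤ l → 1 ≤ m →
      ∀ α ∈ HamForms n ω k, ∀ β ∈ HamForms n ω l, ∀ γ ∈ HamForms n ω m,
      ∀ (X : MultiField E M k) (Y : MultiField E M l) (Z : MultiField E M m),
        IsHamiltonianField ω α X → IsHamiltonianField ω β Y → IsHamiltonianField ω γ Z →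
          (-1 : ℝ) ^ (hamGrade k * hamGrade m) • poisson ω k (l + m - 1) α (poisson ω l m β γ) +
            (-1 : ℝ) ^ (hamGrade l * hamGrade k) • poisson ω l (m + k - 1) β (poisson ω m k γ α) +
            (-1 : ℝ) ^ (hamGrade m * hamGrade l) • poisson ω m (k + l - 1) γ (poisson ω k l α β) =
          (-1 : ℝ) ^ (hamGrade l * hamGrade m + hamGrade l * hamGrade k + hamGrade l) •
            dExt (contract X (contract Y (contract Z ω)))) ∧
    (∃ br : ∀ i j : ℕ, HamQuot n ω i →ₗ[ℝ] HamQuot n ω j →ₗ[ℝ] HamQuot n ω (i + j),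
      (∀ (i j : ℕ) (α : HamForms n ω (i + 1)) (β : HamForms n ω (j + 1)),
        ∃ h : poisson ω (i + 1) (j + 1) α β ∈ HamForms n ω (i + j + 1),
          br i j (Submodule.Quotient.mk α) (Submodule.Quotient.mk β) =
            Submodule.Quotient.mk ⟨poisson ω (i + 1) (j + 1) α β, h⟩) ∧
      IsGradedLieBracket (HamQuot n ω) br) := by
  have hdeg (i j : ℕ) : i + 1 + (j + 1) - 1 = i + j + 1 := by omega
  refine ⟨fun k l hk hl α hα β hβ => ⟨fun X Y hX hY => poisson_eq hX hY, ?_⟩,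
    fun k l _ _ α ⟨_, X, hX⟩ β ⟨_, Y, hY⟩ => poisson_skew hX hY,
    fun k l m hk hl hm α hα β hβ γ hγ X Y Z hX hY hZ => ?_,
    quotBracket hω hdω, fun i j α β => ⟨poisson_mem_hamForms hω hdω α.2 β.2,
      quotBracket_mk hω hdω i j α β⟩, isGradedLieBracket_quotBracket hω hdω⟩
  · obtain ⟨k, rfl⟩ := Nat.exists_eq_add_of_le' hk
    obtain ⟨l, rfl⟩ := Nat.exists_eq_add_of_le' hl
    rw [hdeg]
    exact poisson_mem_hamForms hω hdω hα hβ
  · obtain ⟨k, rfl⟩ := Nat.exists_eq_add_of_le' hk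
    obtain ⟨l, rfl⟩ := Nat.exists_eq_add_of_le' hl
    obtain ⟨m, rfl⟩ := Nat.exists_eq_add_of_le' hm
    rw [hdeg, hdeg, hdeg]
    exact poisson_jacobi hω.1 hdω hα.1.1 hβ.1.1 hγ.1.1 hX hY hZ

theorem mainTheorem8 {E : Type*} [NormedAddCommGroup E] [NormedSpace ℝ E] [FiniteDimensional ℝ E]
    {M : Type*} [TopologicalSpace M] [T2Space M] [SecondCountableTopology M]
    [ChartedSpace E M] [IsManifold 𝓘(ℝ, E) (⊤ : ℕ∞) M]
    (n : ℕ) (hn : 1 ≤ n) (ω : Forms E M) (hω : IsPlectic n ω) :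
    -- the bracket does not depend on the Hamiltonian multivector fields, and it is Hamiltonian
    (∀ k l : ℕ, 1 ≤ k → 1 ≤ l → ∀ α ∈ HamForms n ω k, ∀ β ∈ HamForms n ω l,
      (∀ (X : MultiField E M k) (Y : MultiField E M l),
        IsHamiltonianField ω α X → IsHamiltonianField ω β Y →
          poisson ω k l α β = (-1 : ℝ) ^ hamGrade l • contract Y (contract X ω)) ∧
      poisson ω k l α β ∈ HamForms n ω (k + l - 1)) ∧
    -- graded skew-symmetry
    (∀ k l : ℕ, 1 ≤ k → 1 ≤ l → ∀ α ∈ HamForms n ω k, ∀ β ∈ HamForms n ω l,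
      poisson ω k l α β = -((-1 : ℝ) ^ (hamGrade k * hamGrade l) • poisson ω l k β α)) ∧
    -- graded Jacobi identity up to an exact term
    (∀ k l m : ℕ, 1 ≤ k → 1 ≤ l → 1 ≤ m →
      ∀ α ∈ HamForms n ω k, ∀ β ∈ HamForms n ω l, ∀ γ ∈ HamForms n ω m,
      ∀ (X : MultiField E M k) (Y : MultiField E M l) (Z : MultiField E M m),
        IsHamiltonianField ω α X → IsHamiltonianField ω β Y → IsHamiltonianField ω γ Z →
          (-1 : ℝ) ^ (hamGrade k * hamGrade m) • poisson ω k (l + m - 1) α (poisson ω l m β γ) +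
            (-1 : ℝ) ^ (hamGrade l * hamGrade k) • poisson ω l (m + k - 1) β (poisson ω m k γ α) +
            (-1 : ℝ) ^ (hamGrade m * hamGrade l) • poisson ω m (k + l - 1) γ (poisson ω k l α β) =
          (-1 : ℝ) ^ (hamGrade l * hamGrade m + hamGrade l * hamGrade k + hamGrade l) •
            dExt (contract X (contract Y (contract Z ω)))) ∧
    -- the bracket descends to a graded Lie algebra structure modulo closed forms
    (∃ br : ∀ i j : ℕ, HamQuot n ω i →ₗ[ℝ] HamQuot n ω j →ₗ[ℝ] HamQuot n ω (i + j),
      (∀ (i j : ℕ) (α : HamForms n ω (i + 1)) (β : HamForms n ω (j + 1)),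
        ∃ h : poisson ω (i + 1) (j + 1) α β ∈ HamForms n ω (i + j + 1),
          br i j (Submodule.Quotient.mk α) (Submodule.Quotient.mk β) =
            Submodule.Quotient.mk ⟨poisson ω (i + 1) (j + 1) α β, h⟩) ∧
      IsGradedLieBracket (HamQuot n ω) br) :=
  mainTheorem8_general n ω hω.mem hω.closed
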